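/- Let $\mathbb{H}$ be the quaternions, $\mathbb{D}=\{x\in\mathbb{H}:|x|<1\}$, $\mathbb{S}$ the sphere of imaginary units, $i\in\mathbb{S}$, $\mathbb{C}_i=\{x_0+ix_1: x_0,x_1\in\mathbb{R}\}$, $\mathbb{D}_i=\mathbb{D}\cap\mathbb{C}_i$, and let $m_i$ be the Lebesgue measure on $\mathbb{C}_i$. A real differentiable function $f:\mathbb{D}\to\mathbb{H}$ is called left slice hyperholomorphic if $f(x_0+jx_1)=a(x_0,x_1)+j\,b(x_0,x_1)$ for all $j\in\mathbb{S}$ and $x_0+jx_1\in\mathbb{D}$, with $\mathbb{H}$-valued functions $a,b$ such that $a(x_0,-x_1)=a(x_0,x_1)$, $b(x_0,-x_1)=-b(x_0,x_1)$, $\partial_{x_0}a=\partial_{x_1}b$ and $\partial_{x_0}b=-\partial_{x_1}a$. Let $\alpha>-1$ and $dA_{\alpha,i}(z)=\frac{\alpha+1}{\pi}(1-|z|^2)^\alpha\,dm_i(z)$. The slice weighted Bergman space $\mathcal{A}^2_{\alpha,i}(\mathbb{D})$ is the right quaternionic Hilbert space of all left slice hyperholomorphic $f$ on $\mathbb{D}$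 with $\int_{\mathbb{D}_i}|f|^2\,dA_{\alpha,i}<\infty$, with the scalar product $\langle f,g\rangle=\int_{\mathbb{D}_i}\overline{f(z)}\,g(z)\,dA_{\alpha,i}(z)$. For $w\in\mathbb{D}$ let $K_w$ be its reproducing kernel, i.e. $\langle K_w,f\rangle=f(w)$ for all $f$, and put $k_w=K_w/\sqrt{K_w(w)}$. Let $T$ be a bounded right linear operator on $\mathcal{A}^2_{\alpha,i}(\mathbb{D})$ that is positive, i.e. $\langle f,Tf\rangle$ is real and $\geq 0$ for all $f$. Let $\widetilde T(z)=\langle k_z,Tk_z\rangle$, $z\in\mathbb{D}_i$, be its Berezin transform, and let $\lambda_{n+1}=\inf\{\|T-F\|: F \text{ bounded right linear},\ \operatorname{rank}F\le n\}$, $n=0,1,2,\dots$, be its singular values. Then, with the Möbius invariant measure $d\mu_i(z)=\frac{1}{\pi(1-|z|^2)^2}\,dm_i(z)$ on $\mathbb{D}_i$, $$\sum_{n=1}^{\infty}\lambda_n=(\alpha+1)\int_{\mathbb{D}_i}\widetilde T(z)\,d\mu_i(z),$$ as an equality in $[0,+\infty]$. The same equality holds if $(\lambda_n)_{n\ge1}$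 is instead the decreasing sequence of nonnegative coefficients in any singular value decomposition $Tf=\sum_{n}\sigma_n\lambda_n\langle e_n,f\rangle$ with orthonormal sequences $(e_n)$ and $(\sigma_n)$; for compact $T$, this is the usual definition of the singular values. -/

import Mathlib

open MeasureTheory
open scoped Quaternion ENNReal

noncomputable section

namespace SliceBergman

/-- The sphere `𝕊` of imaginary units of the quaternions. -/
def imaginaryUnits : Set ℍ := {x | x.re = 0 ∧ ‖x‖ = 1}

/-- The open unit ball `𝔻` of the quaternions. -/
def unitBall : Set ℍ := Metric.ball 0 1

/-- The point `x₀ + J x₁` of the slice `ℂ_J`, for `z = x₀ + x₁ √-1`. For `J ∈ 𝕊` this is the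
standard identification of `ℂ` with `ℂ_J`; it maps the complex unit disc onto `𝔻 ∩ ℂ_J`. -/
def slicePoint (J : ℍ) (z : ℂ) : ℍ := (z.re : ℍ) + J * (z.im : ℍ)

/-- The pairs `(x₀, x₁)`, seen as points `x₀ + x₁ √-1` of the plane, that parametrize `U`. -/
def profile (U : Set ℍ) : Set ℂ := {z | ∃ J ∈ imaginaryUnits, slicePoint J z ∈ U}

/-- Left slice hyperholomorphic functions on an axially symmetric open set `U`: real differentiable
functions of the form `f (x₀ + J x₁) = a (x₀, x₁) + J b (x₀, x₁)`, for all imaginary units `J`,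
where `a` is even and `b` is odd in `x₁`, and `a`, `b` satisfy the Cauchy-Riemann system
`∂a/∂x₀ = ∂b/∂x₁`, `∂b/∂x₀ = -∂a/∂x₁`.
The plane of the pairs `(x₀, x₁)` is written as `ℂ`, so that `(x₀, -x₁)` is the conjugate, and the
partial derivatives are the derivatives in the directions `1` and `Complex.I`. -/
def IsLeftSliceHyperholomorphic (U : Set ℍ) (f : ℍ → ℍ) : Prop :=
  DifferentiableOn ℝ f U ∧
  ∃ a b : ℂ → ℍ,
    (∀ J ∈ imaginaryUnits, ∀ z : ℂ, slicePoint J z ∈ U → f (slicePoint J z) = a z + J * b z) ∧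
    (∀ z ∈ profile U, a (star z) = a z ∧ b (star z) = -b z) ∧
    (∀ z ∈ profile U, DifferentiableAt ℝ a z ∧ DifferentiableAt ℝ b z) ∧
    (∀ z ∈ profile U, fderiv ℝ a z 1 = fderiv ℝ b z Complex.I ∧
      fderiv ℝ b z 1 = -fderiv ℝ a z Complex.I)

/-- The measure `dA_α = (α + 1) / π * (1 - |z|²)^α dm` on the unit disc, `dm` being the Lebesgue
measure of the plane. -/
def weightedArea (α : ℝ) : Measure ℂ :=
  (volume.restrict (Metric.ball 0 1)).withDensity
    fun z => ENNReal.ofReal ((α + 1) / Real.pi * (1 - ‖z‖ ^ 2) ^ α)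

/-- The Möbius invariant measure `dμ = dm / (π (1 - |z|²)²)` on the unit disc. -/
def mobiusMeasure : Measure ℂ :=
  (volume.restrict (Metric.ball 0 1)).withDensity
    fun z => ENNReal.ofReal (1 / (Real.pi * (1 - ‖z‖ ^ 2) ^ 2))

theorem IsLeftSliceHyperholomorphic.add {U : Set ℍ} {f g : ℍ → ℍ}
    (hf : IsLeftSliceHyperholomorphic U f) (hg : IsLeftSliceHyperholomorphic U g) :
    IsLeftSliceHyperholomorphic U (f + g) := by
  obtain ⟨hfd, a, b, hab, hsym, hd, hcr⟩ := hf
  obtain ⟨hgd, a', b', hab', hsym', hd', hcr'⟩ := hg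
  refine ⟨hfd.add hgd, a + a', b + b', ?_, ?_, ?_, ?_⟩
  · intro J hJ z hz
    simp only [Pi.add_apply, hab J hJ z hz, hab' J hJ z hz, mul_add]
    abel
  · intro z hz
    simp only [Pi.add_apply, (hsym z hz).1, (hsym z hz).2, (hsym' z hz).1, (hsym' z hz).2]
    exact ⟨trivial, by abel⟩
  · intro z hz
    exact ⟨(hd z hz).1.add (hd' z hz).1, (hd z hz).2.add (hd' z hz).2⟩
  · intro z hz
    rw [fderiv_add (hd z hz).1 (hd' z hz).1, fderiv_add (hd z hz).2 (hd' z hz).2]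
    simp only [add_apply, (hcr z hz).1, (hcr z hz).2, (hcr' z hz).1,
      (hcr' z hz).2]
    exact ⟨trivial, by abel⟩

theorem IsLeftSliceHyperholomorphic.zero (U : Set ℍ) :
    IsLeftSliceHyperholomorphic U (0 : ℍ → ℍ) := by
  refine ⟨differentiableOn_const 0, 0, 0, ?_, ?_, ?_, ?_⟩
  · intro J _ z _
    simp
  · intro z _
    simp
  · intro z _
    exact ⟨differentiableAt_const 0, differentiableAt_const 0⟩
  · intro z _
    simp

/-- Right multiplication by a quaternion, as a real continuous linear map. -/
def mulRight (q : ℍ) : ℍ →L[ℝ] ℍ := (ContinuousLinearMap.mul ℝ ℍ).flip q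

theorem IsLeftSliceHyperholomorphic.mul_right {U : Set ℍ} {f : ℍ → ℍ}
    (hf : IsLeftSliceHyperholomorphic U f) (q : ℍ) :
    IsLeftSliceHyperholomorphic U (fun x => f x * q) := by
  obtain ⟨hfd, a, b, hab, hsym, hd, hcr⟩ := hf
  refine ⟨(mulRight q).differentiable.comp_differentiableOn hfd,
    fun z => mulRight q (a z), fun z => mulRight q (b z), ?_, ?_, ?_, ?_⟩
  · intro J hJ z hz
    simp only [hab J hJ z hz, mulRight, ContinuousLinearMap.flip_apply,
      ContinuousLinearMap.mul_apply', add_mul, mul_assoc]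
  · intro z hz
    simp only [(hsym z hz).1, (hsym z hz).2, map_neg]
    exact ⟨trivial, trivial⟩
  · intro z hz
    exact ⟨(mulRight q).differentiableAt.comp z (hd z hz).1,
      (mulRight q).differentiableAt.comp z (hd z hz).2⟩
  · intro z hz
    have h1 := ((mulRight q).hasFDerivAt.comp z (hd z hz).1.hasFDerivAt).fderiv
    have h2 := ((mulRight q).hasFDerivAt.comp z (hd z hz).2.hasFDerivAt).fderiv
    simp only [Function.comp_def] at h1 h2
    rw [h1, h2]
    simp only [ContinuousLinearMap.comp_apply, (hcr z hz).1, (hcr z hz).2, map_neg]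
    exact ⟨trivial, trivial⟩

/-- The slice Bergman space as a right quaternionic vector space, that is, as a submodule over
`ℍᵐᵒᵖ`: all left slice hyperholomorphic functions on `𝔻` that are square integrable on `𝔻_i` with
respect to `dA_α`. A function on `𝔻` is represented by its extension by `0` to all of `ℍ`. -/
def bergmanSubmodule (α : ℝ) (i : imaginaryUnits) : Submodule ℍᵐᵒᵖ (ℍ → ℍ) where
  carrier := {f | IsLeftSliceHyperholomorphic unitBall f ∧ (∀ x ∉ unitBall, f x = 0) ∧
    MemLp (fun z => f (slicePoint i z)) 2 (weightedArea α)}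
  add_mem' := by
    rintro f g ⟨hf, hf0, hfL⟩ ⟨hg, hg0, hgL⟩
    refine ⟨hf.add hg, fun x hx => ?_, hfL.add hgL⟩
    simp [hf0 x hx, hg0 x hx]
  zero_mem' := ⟨IsLeftSliceHyperholomorphic.zero _, fun _ _ => rfl, MemLp.zero⟩
  smul_mem' := by
    rintro q f ⟨hf, hf0, hfL⟩
    refine ⟨hf.mul_right q.unop, fun x hx => ?_, (mulRight q.unop).comp_memLp' hfL⟩
    simp [hf0 x hx]

/-- The weighted slice Bergman space `A²_{α,i}(𝔻)`. -/
def BergmanSpace (α : ℝ) (i : imaginaryUnits) : Type := bergmanSubmodule α i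

variable {α : ℝ} {i : imaginaryUnits}

instance : AddCommGroup (BergmanSpace α i) :=
  inferInstanceAs (AddCommGroup (bergmanSubmodule α i))

instance : Module ℍᵐᵒᵖ (BergmanSpace α i) :=
  inferInstanceAs (Module ℍᵐᵒᵖ (bergmanSubmodule α i))

instance : CoeFun (BergmanSpace α i) (fun _ => ℍ → ℍ) := ⟨fun f => f.1⟩

theorem BergmanSpace.memLp (f : BergmanSpace α i) :
    MemLp (fun z => f (slicePoint i z)) 2 (weightedArea α) := f.2.2.2

/-- Restriction to the slice `𝔻_i`, as a map into `L²(dA_α)`. -/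
def BergmanSpace.toL2 (α : ℝ) (i : imaginaryUnits) :
    BergmanSpace α i →+ Lp ℍ 2 (weightedArea α) where
  toFun f := f.memLp.toLp _
  map_zero' := rfl
  map_add' _ _ := rfl

/-- The norm `‖f‖ = (∫_{𝔻_i} |f|² dA_α)^{1/2}`. For `α > -1` it is definite. -/
instance : SeminormedAddCommGroup (BergmanSpace α i) :=
  SeminormedAddCommGroup.induced _ _ (BergmanSpace.toL2 α i)

theorem BergmanSpace.norm_sq_eq (f : BergmanSpace α i) :
    ‖f‖ ^ 2 = ∫ z, ‖f (slicePoint i z)‖ ^ 2 ∂weightedArea α := by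
  have h : ‖f‖ = (eLpNorm (fun z => f (slicePoint i z)) 2 (weightedArea α)).toReal :=
    Lp.norm_toLp _ f.memLp
  rw [h, f.memLp.eLpNorm_eq_integral_rpow_norm (by norm_num) (by norm_num),
    ENNReal.toReal_ofReal (by positivity), ← Real.rpow_natCast, ← Real.rpow_mul (by positivity)]
  norm_num

/-- The scalar product `⟨f, g⟩ = ∫_{𝔻_i} conj (f z) * g z dA_α(z)`, right linear in `g`. -/
instance : Inner ℍ (BergmanSpace α i) :=
  ⟨fun f g => ∫ z, star (f (slicePoint i z)) * g (slicePoint i z) ∂weightedArea α⟩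

open Classical in
/-- The reproducing kernel `K_w`: the element of the space with `⟨K_w, f⟩ = f w` for all `f`
(with the value `0` in case there is none, which does not happen for `α > -1` and `w ∈ 𝔻`). -/
def kernel (α : ℝ) (i : imaginaryUnits) (w : ℍ) : BergmanSpace α i :=
  if h : ∃ K : BergmanSpace α i, ∀ f : BergmanSpace α i, inner ℍ K f = f w then h.choose else 0

/-- The normalized reproducing kernel `k_w = K_w / √K(w, w)`, where `K(q, w) = K_w q`
(the number `K(w, w) = ‖K_w‖²` is real). -/
def normalizedKernel (α : ℝ) (i : imaginaryUnits) (w : ℍ) : BergmanSpace α i :=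
  MulOpposite.op (((Real.sqrt (kernel α i w w).re)⁻¹ : ℝ) : ℍ) • kernel α i w

/-- The Berezin transform `T̃(w) = ⟨k_w, T k_w⟩` of a bounded right linear operator. -/
def berezin (T : BergmanSpace α i →L[ℍᵐᵒᵖ] BergmanSpace α i) (w : ℍ) : ℍ :=
  inner ℍ (normalizedKernel α i w) (T (normalizedKernel α i w))

section Operators

variable {E : Type*} [SeminormedAddCommGroup E] [Module ℍᵐᵒᵖ E]

/-- `T` is positive: `⟨x, T x⟩` is a nonnegative real number for every `x`. -/
def IsPositiveOperator [Inner ℍ E] (T : E →L[ℍᵐᵒᵖ] E) : Prop :=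
  ∀ x : E, (inner ℍ x (T x) : ℍ).im = 0 ∧ 0 ≤ (inner ℍ x (T x) : ℍ).re

/-- Orthonormal sequences for a quaternionic scalar product. -/
def IsOrthonormalSeq [Inner ℍ E] (e : ℕ → E) : Prop :=
  ∀ m n, inner ℍ (e m) (e n) = if m = n then (1 : ℍ) else 0

/-- `s 0 ≥ s 1 ≥ …` are the coefficients of a singular value decomposition
`T x = ∑ σ_n s_n ⟨e_n, x⟩` with orthonormal sequences `e` and `σ`. -/
def IsSingularValueSeq [Inner ℍ E] (T : E →L[ℍᵐᵒᵖ] E) (s : ℕ → ℝ) : Prop :=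
  (∀ n, 0 ≤ s n) ∧ Antitone s ∧ ∃ e σ : ℕ → E, IsOrthonormalSeq e ∧ IsOrthonormalSeq σ ∧
    ∀ x : E, HasSum (fun n => MulOpposite.op ((s n : ℍ) * inner ℍ (e n) x) • σ n) (T x)

/-- The operator norm of a bounded right linear operator. -/
def operatorNorm (T : E →L[ℍᵐᵒᵖ] E) : ℝ := sInf {c : ℝ | 0 ≤ c ∧ ∀ x, ‖T x‖ ≤ c * ‖x‖}

/-- The singular numbers `s_n(T) = inf {‖T - F‖ : rank F ≤ n}`, `n = 0, 1, 2, …`, of a bounded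
right linear operator, compact or not. -/
def singularNumber (T : E →L[ℍᵐᵒᵖ] E) (n : ℕ) : ℝ :=
  ⨅ F : {F : E →L[ℍᵐᵒᵖ] E // LinearMap.rank (F : E →ₗ[ℍᵐᵒᵖ] E) ≤ (n : Cardinal)},
    operatorNorm (T - F.1)

end Operators

end SliceBergman

end

/-!
By the reproducing property the kernels `K_z`, `z ∈ 𝔻_i`, are a continuous Parseval frame for the
measure `dA_α`: `∫ ‖⟨K_z, f⟩‖² dA_α = ‖f‖²`. Since `‖K_z‖² = (1 - |z|²)^{-(α+2)}` turns `dA_α` into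
`(α + 1) dμ`, the right hand side of the formula is `∫ ⟨K_z, T K_z⟩ dA_α`, the trace of `T` tested
on this frame, and it remains to see that the trace of a positive `T` is the sum of its singular
numbers. Subtracting rank one operators from `T` one after the other, each time keeping the
remainder positive, bounds that sum above by the trace; Ky Fan's inequality on the spans of the
monomials, which exhaust the space, bounds it below. For a singular value decomposition the
coefficients are the approximation numbers: truncation gives one inequality, and an operator of rank
at most `n` has a kernel vector among the combinations of `n + 1` of the vectors `e_k`, which gives
the other.
-/

noncomputable section

namespace SliceBergman

open MulOpposite Filter Topology
open scoped InnerProductSpace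

/-! ### Quaternions -/

theorem quaternion_re_le_norm (q : ℍ) : q.re ≤ ‖q‖ := by
  simpa [Quaternion.inner_def] using real_inner_le_norm q 1

theorem quaternion_re_mul_comm (p q : ℍ) : (p * q).re = (q * p).re := by
  simp only [Quaternion.re_mul]
  ring

/-- The real part of a quaternion, as a real continuous linear map. -/
def quaternionReCLM : ℍ →L[ℝ] ℝ where
  toLinearMap := QuaternionAlgebra.reₗ _ _ _
  cont := Quaternion.continuous_re

theorem quaternion_re_sum {ι : Type*} (s : Finset ι) (q : ι → ℍ) :
    (∑ k ∈ s, q k).re = ∑ k ∈ s, (q k).re := map_sum quaternionReCLM q s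

theorem quaternion_star_mul_self (q : ℍ) : star q * q = ((‖q‖ ^ 2 : ℝ) : ℍ) := by
  rw [Quaternion.star_mul_self, Quaternion.normSq_eq_norm_mul_self, sq]

theorem quaternion_self_mul_star (q : ℍ) : q * star q = ((‖q‖ ^ 2 : ℝ) : ℍ) := by
  rw [Quaternion.self_mul_star, Quaternion.normSq_eq_norm_mul_self, sq]

theorem quaternion_exists_star_ne : ∃ q : ℍ, star q ≠ q :=
  ⟨⟨0, 1, 0, 0⟩, fun h => by
    have : (-1 : ℝ) = 1 := congrArg QuaternionAlgebra.imI h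
    norm_num at this⟩

theorem quaternion_eq_zero_of_forall_star_mul {d : ℍ} (h : ∀ q : ℍ, star (q * d) = q * d) :
    d = 0 := by
  by_contra hd
  obtain ⟨q, hq⟩ := quaternion_exists_star_ne
  exact hq (by simpa [mul_assoc, hd] using h (q * d⁻¹))

/-! ### Operator norm and singular numbers -/

section OperatorNorm

variable {E : Type*} [SeminormedAddCommGroup E] [Module ℍᵐᵒᵖ E] {T F : E →L[ℍᵐᵒᵖ] E} {n : ℕ}

theorem operatorNorm_nonneg (T : E →L[ℍᵐᵒᵖ] E) : 0 ≤ operatorNorm T :=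
  Real.sInf_nonneg fun _ h => h.1

theorem operatorNorm_le_of_bound {c : ℝ} (hc : 0 ≤ c) (h : ∀ x, ‖T x‖ ≤ c * ‖x‖) :
    operatorNorm T ≤ c :=
  csInf_le ⟨0, fun _ h => h.1⟩ ⟨hc, h⟩

theorem singularNumber_le (hF : LinearMap.rank (F : E →ₗ[ℍᵐᵒᵖ] E) ≤ n) :
    singularNumber T n ≤ operatorNorm (T - F) :=
  ciInf_le (f := fun F : {F : E →L[ℍᵐᵒᵖ] E // LinearMap.rank (F : E →ₗ[ℍᵐᵒᵖ] E) ≤ n} =>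
    operatorNorm (T - F.1)) ⟨0, Set.forall_mem_range.2 fun _ => operatorNorm_nonneg _⟩ ⟨F, hF⟩

theorem exists_operatorNorm_sub_lt {c : ℝ} (hc : singularNumber T n < c) :
    ∃ F : E →L[ℍᵐᵒᵖ] E, LinearMap.rank (F : E →ₗ[ℍᵐᵒᵖ] E) ≤ n ∧ operatorNorm (T - F) < c := by
  have : Nonempty {F : E →L[ℍᵐᵒᵖ] E // LinearMap.rank (F : E →ₗ[ℍᵐᵒᵖ] E) ≤ n} :=
    ⟨0, by simp [LinearMap.rank_zero]⟩
  obtain ⟨F, hF⟩ := exists_lt_of_ciInf_lt hc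
  exact ⟨F.1, F.2, hF⟩

theorem le_singularNumber {c : ℝ} (h : ∀ F : E →L[ℍᵐᵒᵖ] E,
    LinearMap.rank (F : E →ₗ[ℍᵐᵒᵖ] E) ≤ n → c ≤ operatorNorm (T - F)) :
    c ≤ singularNumber T n := by
  by_contra! hc
  obtain ⟨F, hF, hlt⟩ := exists_operatorNorm_sub_lt hc
  exact (h F hF).not_gt hlt

theorem singularNumber_nonneg (T : E →L[ℍᵐᵒᵖ] E) (n : ℕ) : 0 ≤ singularNumber T n :=
  le_singularNumber fun _ _ => operatorNorm_nonneg _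

end OperatorNorm

/-! ### Quaternionic scalar products -/

/-- Right quaternionic pre-Hilbert spaces. The scalar product is right linear in its second
argument, and the seminorm is the one it induces; it need not be definite. -/
class QuaternionicInnerProductSpace (E : Type*) [SeminormedAddCommGroup E] [Module ℍᵐᵒᵖ E]
    [Inner ℍ E] : Prop where
  star_inner (x y : E) : star ⟪x, y⟫_ℍ = ⟪y, x⟫_ℍ
  inner_add (x y z : E) : ⟪x, y + z⟫_ℍ = ⟪x, y⟫_ℍ + ⟪x, z⟫_ℍ
  inner_op_smul (x y : E) (q : ℍ) : ⟪x, op q • y⟫_ℍ = ⟪x, y⟫_ℍ * q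
  inner_self_eq (x : E) : ⟪x, x⟫_ℍ = ((‖x‖ ^ 2 : ℝ) : ℍ)

/-! ### Orthonormal families -/

section Orthonormal

variable {E : Type*} [Inner ℍ E] {ι : Type*} [DecidableEq ι] {e : ι → E}

/-- Orthonormal families indexed by an arbitrary type; `IsOrthonormalSeq` is the case of `ℕ`. -/
def IsOrthonormalFamily (e : ι → E) : Prop :=
  ∀ j k, ⟪e j, e k⟫_ℍ = if j = k then 1 else 0

theorem IsOrthonormalFamily.comp {κ : Type*} [DecidableEq κ] (he : IsOrthonormalFamily e)
    {f : κ → ι} (hf : Function.Injective f) : IsOrthonormalFamily (e ∘ f) := fun j k => by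
  simp only [Function.comp_apply, he _ _, hf.eq_iff]

theorem IsOrthonormalFamily.inner_self_eq_one (he : IsOrthonormalFamily e) (k : ι) :
    ⟪e k, e k⟫_ℍ = 1 := by
  rw [he, if_pos rfl]

end Orthonormal

section ParsevalFrame

variable {E : Type*} [Inner ℍ E] {X : Type*} [MeasurableSpace X] {k : X → E} {ν : Measure X}

/-- Continuous Parseval frames: `⟨f, g⟩ = ∫ ⟨f, k x⟩ ⟨k x, g⟩ dν(x)` for all `f` and `g`. -/
structure IsParsevalFrame (k : X → E) (ν : Measure X) : Prop where
  integrable (f g : E) : Integrable (fun x => ⟪f, k x⟫_ℍ * ⟪k x, g⟫_ℍ) ν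
  integral_eq (f g : E) : ∫ x, ⟪f, k x⟫_ℍ * ⟪k x, g⟫_ℍ ∂ν = ⟪f, g⟫_ℍ

theorem IsParsevalFrame.integrable_re (hk : IsParsevalFrame k ν) (f g : E) :
    Integrable (fun x => (⟪f, k x⟫_ℍ * ⟪k x, g⟫_ℍ : ℍ).re) ν :=
  quaternionReCLM.integrable_comp (hk.integrable f g)

theorem IsParsevalFrame.integral_re (hk : IsParsevalFrame k ν) (f g : E) :
    ∫ x, (⟪f, k x⟫_ℍ * ⟪k x, g⟫_ℍ : ℍ).re ∂ν = (⟪f, g⟫_ℍ : ℍ).re := by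
  rw [← hk.integral_eq]
  exact quaternionReCLM.integral_comp_comm (hk.integrable f g)

end ParsevalFrame

theorem IsPositiveOperator.inner_apply_self_eq_re {E : Type*} [SeminormedAddCommGroup E]
    [Module ℍᵐᵒᵖ E] [Inner ℍ E] {T : E →L[ℍᵐᵒᵖ] E} (hT : IsPositiveOperator T) (x : E) :
    ⟪x, T x⟫_ℍ = ((⟪x, T x⟫_ℍ : ℍ).re : ℍ) := by
  conv_lhs => rw [← Quaternion.re_add_im ⟪x, T x⟫_ℍ, (hT x).1, add_zero]

section InnerProduct

open QuaternionicInnerProductSpace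

variable {E : Type*} [SeminormedAddCommGroup E] [Module ℍᵐᵒᵖ E] [Inner ℍ E]
  [QuaternionicInnerProductSpace E]

theorem add_inner (x y z : E) : ⟪x + y, z⟫_ℍ = ⟪x, z⟫_ℍ + ⟪y, z⟫_ℍ := by
  rw [← star_inner, inner_add, star_add, star_inner, star_inner]

theorem op_smul_inner (q : ℍ) (x y : E) : ⟪op q • x, y⟫_ℍ = star q * ⟪x, y⟫_ℍ := by
  rw [← star_inner, inner_op_smul, star_mul, star_inner]

theorem re_inner_self (x : E) : (⟪x, x⟫_ℍ : ℍ).re = ‖x‖ ^ 2 := by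
  rw [inner_self_eq, Quaternion.re_coe]

theorem norm_op_smul (q : ℍ) (x : E) : ‖op q • x‖ = ‖q‖ * ‖x‖ := by
  refine (pow_left_inj₀ (norm_nonneg _) (by positivity) two_ne_zero).1 ?_
  rw [← re_inner_self, op_smul_inner, inner_op_smul, inner_self_eq, Quaternion.coe_commutes,
    ← mul_assoc, quaternion_star_mul_self, ← Quaternion.coe_mul, Quaternion.re_coe, mul_pow]

theorem norm_apply_le_operatorNorm_mul (T : E →L[ℍᵐᵒᵖ] E) (x : E) :
    ‖T x‖ ≤ operatorNorm T * ‖x‖ := by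
  let : NormedSpace ℝ E :=
    { Module.compHom E (algebraMap ℝ ℍᵐᵒᵖ) with
      norm_smul_le := fun r x => by
        rw [← Quaternion.norm_coe]
        exact (norm_op_smul (r : ℍ) x).le }
  have : IsScalarTower ℝ ℍᵐᵒᵖ E := ⟨fun r q x => by
    rw [Algebra.smul_def, mul_smul]
    rfl⟩
  exact (T.restrictScalars ℝ).le_opNorm x

/-! ### Positive operators -/

section Positive

variable {T : E →L[ℍᵐᵒᵖ] E}

theorem isPositiveOperator_id : IsPositiveOperator (ContinuousLinearMap.id ℍᵐᵒᵖ E) := fun x => by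
  simp only [ContinuousLinearMap.id_apply, inner_self_eq, Quaternion.im_coe, Quaternion.re_coe]
  exact ⟨trivial, by positivity⟩

/-- Polarization: comparing `⟨z, T z⟩` with its conjugate for `z = x q̄ + y` shows that all left
multiples of `⟨T x, y⟩ - ⟨x, T y⟩` are real. -/
theorem IsPositiveOperator.inner_apply_left (hT : IsPositiveOperator T) (x y : E) :
    ⟪T x, y⟫_ℍ = ⟪x, T y⟫_ℍ := by
  refine sub_eq_zero.1 (quaternion_eq_zero_of_forall_star_mul fun q => ?_)
  have real_diagonal (z : E) : star ⟪z, T z⟫_ℍ = ⟪z, T z⟫_ℍ :=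
    Quaternion.star_eq_self.2 (hT.inner_apply_self_eq_re z)
  have h := real_diagonal (op (star q) • x + y)
  simp only [map_add, map_smul, inner_add, add_inner, inner_op_smul, op_smul_inner, star_add,
    star_mul, star_star, real_diagonal x, real_diagonal y] at h
  rw [star_mul, star_sub, star_inner, mul_sub, sub_mul, sub_eq_sub_iff_add_eq_add,
    ← star_inner y (T x)]
  refine add_left_cancel (a := q * ⟪x, T x⟫_ℍ * star q) (add_right_cancel (b := ⟪y, T y⟫_ℍ) ?_)
  convert h.symm using 1 <;> simp only [mul_add, add_mul, mul_assoc] <;> abel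

theorem IsPositiveOperator.norm_inner_sq_le (hT : IsPositiveOperator T) (x y : E) :
    ‖⟪x, T y⟫_ℍ‖ ^ 2 ≤ (⟪x, T x⟫_ℍ : ℍ).re * (⟪y, T y⟫_ℍ : ℍ).re := by
  set b : ℍ := ⟪x, T y⟫_ℍ with hb
  have quadratic_nonneg (t : ℝ) : 0 ≤ ‖b‖ ^ 2 * (⟪y, T y⟫_ℍ : ℍ).re * (t * t) +
      -(2 * ‖b‖ ^ 2) * t + (⟪x, T x⟫_ℍ : ℍ).re := by
    obtain ⟨r, hr⟩ : ∃ r : ℝ, ⟪y, T y⟫_ℍ = r := ⟨_, hT.inner_apply_self_eq_re y⟩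
    have hyx : ⟪y, T x⟫_ℍ = star b := by rw [hb, star_inner, hT.inner_apply_left]
    have h := (hT (x + op (-t • star b) • y)).2
    simp only [map_add, map_smul, inner_add, add_inner, inner_op_smul, op_smul_inner, hyx, ← hb,
      hr, Quaternion.star_smul, star_star, smul_mul_assoc, mul_smul_comm,
      Quaternion.mul_coe_eq_smul, add_mul, quaternion_self_mul_star, Quaternion.re_add,
      Quaternion.re_smul, Quaternion.re_coe, smul_eq_mul] at h ⊢
    linarith
  have h := discrim_le_zero quadratic_nonneg
  rw [discrim] at h
  rcases (sq_nonneg ‖b‖).eq_or_lt' with h0 | h0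
  · rw [h0]
    exact mul_nonneg (hT x).2 (hT y).2
  · nlinarith

theorem norm_inner_le_norm_mul (x y : E) : ‖⟪x, y⟫_ℍ‖ ≤ ‖x‖ * ‖y‖ := by
  have h := isPositiveOperator_id.norm_inner_sq_le x y
  simp only [ContinuousLinearMap.id_apply, re_inner_self, ← mul_pow] at h
  exact le_of_sq_le_sq h (by positivity)

end Positive

/-! ### Operators of rank one -/

/-- The bounded right linear functional `x ↦ ⟨u, x⟩`. -/
def innerCLM (u : E) : E →L[ℍᵐᵒᵖ] ℍ where
  toFun x := ⟪u, x⟫_ℍ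
  map_add' := inner_add u
  map_smul' q x := inner_op_smul u x q.unop
  cont := AddMonoidHomClass.continuous_of_bound
    (AddMonoidHom.mk' (fun x => ⟪u, x⟫_ℍ) (inner_add u)) ‖u‖ (norm_inner_le_norm_mul u)

/-- The operator `x ↦ u ⟨v, x⟩`. -/
def rankOne (u v : E) : E →L[ℍᵐᵒᵖ] E where
  toFun x := op ⟪v, x⟫_ℍ • u
  map_add' x y := by rw [inner_add, op_add, add_smul]
  map_smul' q x := by
    rw [← op_unop q, inner_op_smul, op_mul, mul_smul, RingHom.id_apply]
  cont := AddMonoidHomClass.continuous_of_bound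
    (AddMonoidHom.mk' (fun x => op ⟪v, x⟫_ℍ • u) fun x y => by rw [inner_add, op_add, add_smul])
    (‖v‖ * ‖u‖) fun x => by
      rw [AddMonoidHom.mk'_apply, norm_op_smul, mul_right_comm]
      gcongr
      exact norm_inner_le_norm_mul v x

@[simp]
theorem innerCLM_apply (u x : E) : innerCLM u x = ⟪u, x⟫_ℍ := rfl

@[simp]
theorem rankOne_apply (u v x : E) : rankOne u v x = op ⟪v, x⟫_ℍ • u := rfl

theorem inner_sub (x y z : E) : ⟪x, y - z⟫_ℍ = ⟪x, y⟫_ℍ - ⟪x, z⟫_ℍ := map_sub (innerCLM x) y z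

theorem inner_sum {ι : Type*} (s : Finset ι) (x : E) (y : ι → E) :
    ⟪x, ∑ k ∈ s, y k⟫_ℍ = ∑ k ∈ s, ⟪x, y k⟫_ℍ := map_sum (innerCLM x) y s

theorem rank_rankOne_le_one (u v : E) :
    LinearMap.rank (rankOne u v : E →ₗ[ℍᵐᵒᵖ] E) ≤ 1 := by
  have hrange : LinearMap.range (rankOne u v : E →ₗ[ℍᵐᵒᵖ] E) ≤ ℍᵐᵒᵖ ∙ u := by
    rintro _ ⟨x, rfl⟩
    exact Submodule.smul_mem _ _ (Submodule.mem_span_singleton_self u)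
  exact (Submodule.rank_mono hrange).trans ((rank_span_le _).trans (Cardinal.mk_singleton u).le)

theorem rank_sum_rankOne_le (n : ℕ) (u v : ℕ → E) :
    LinearMap.rank ((∑ k ∈ Finset.range n, rankOne (u k) (v k) : E →L[ℍᵐᵒᵖ] E) :
      E →ₗ[ℍᵐᵒᵖ] E) ≤ n := by
  rw [ContinuousLinearMap.toLinearMap_sum]
  calc _ ≤ _ := LinearMap.rank_finsetSum_le _ _
    _ ≤ ∑ _k ∈ Finset.range n, 1 := Finset.sum_le_sum fun k _ => rank_rankOne_le_one _ _
    _ = n := by simp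

theorem inner_rankOne_apply_self (u x : E) :
    ⟪x, rankOne u u x⟫_ℍ = ((‖⟪u, x⟫_ℍ‖ ^ 2 : ℝ) : ℍ) := by
  rw [rankOne_apply, inner_op_smul, ← star_inner u x, quaternion_star_mul_self]

/-! ### Deflation of a positive operator -/

theorem IsPositiveOperator.sub_rankOne {T : E →L[ℍᵐᵒᵖ] E} (hT : IsPositiveOperator T) {x : E}
    (hx : 0 < (⟪x, T x⟫_ℍ : ℍ).re) {u : E}
    (hu : u = op (((√(⟪x, T x⟫_ℍ : ℍ).re)⁻¹ : ℝ) : ℍ) • T x) :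
    IsPositiveOperator (T - rankOne u u) := fun y => by
  have hnorm : ‖⟪u, y⟫_ℍ‖ ^ 2 = ((⟪x, T x⟫_ℍ : ℍ).re)⁻¹ * ‖⟪x, T y⟫_ℍ‖ ^ 2 := by
    rw [hu, op_smul_inner, hT.inner_apply_left, norm_mul, norm_star, Quaternion.norm_coe,
      mul_pow, Real.norm_eq_abs, sq_abs, inv_pow, Real.sq_sqrt hx.le]
  rw [sub_apply, inner_sub, inner_rankOne_apply_self, hnorm,
    Quaternion.im_sub, Quaternion.re_sub, Quaternion.im_coe, Quaternion.re_coe, sub_zero,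
    sub_nonneg, inv_mul_le_iff₀ hx]
  exact ⟨(hT y).1, hT.norm_inner_sq_le x y⟩

theorem IsPositiveOperator.re_inner_pos {T : E →L[ℍᵐᵒᵖ] E} (hT : IsPositiveOperator T) {x : E}
    (hx : 0 < ‖T x‖) : 0 < (⟪x, T x⟫_ℍ : ℍ).re := by
  refine (hT x).2.lt_of_ne' fun h0 => ?_
  have h := hT.norm_inner_sq_le x (T x)
  rw [h0, zero_mul, ← hT.inner_apply_left, inner_self_eq, Quaternion.norm_coe,
    Real.norm_eq_abs, sq_abs] at h
  exact (by positivity : 0 < (‖T x‖ ^ 2) ^ 2).not_ge h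

theorem IsPositiveOperator.exists_sub_rankOne {T : E →L[ℍᵐᵒᵖ] E} (hT : IsPositiveOperator T)
    {c : ℝ} (hc : c < operatorNorm T) :
    ∃ u : E, c ≤ ‖u‖ ^ 2 ∧ IsPositiveOperator (T - rankOne u u) := by
  rcases lt_or_ge c 0 with hc0 | hc0
  · refine ⟨0, by simpa using hc0.le, ?_⟩
    convert hT using 1
    ext x
    simp
  obtain ⟨x, hx⟩ : ∃ x, c * ‖x‖ < ‖T x‖ := by
    by_contra! h
    exact (operatorNorm_le_of_bound hc0 h).not_gt hc
  have hTx : 0 < ‖T x‖ := (by positivity : 0 ≤ c * ‖x‖).trans_lt hx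
  have hpos := hT.re_inner_pos hTx
  refine ⟨_, ?_, hT.sub_rankOne hpos rfl⟩
  rw [norm_op_smul, Quaternion.norm_coe, mul_pow, Real.norm_eq_abs, sq_abs, inv_pow,
    Real.sq_sqrt hpos.le, le_inv_mul_iff₀ hpos]
  calc (⟪x, T x⟫_ℍ : ℍ).re * c ≤ ‖x‖ * ‖T x‖ * c := by
        gcongr
        exact (quaternion_re_le_norm _).trans (norm_inner_le_norm_mul _ _)
    _ = c * ‖x‖ * ‖T x‖ := by ring
    _ ≤ ‖T x‖ ^ 2 := by rw [sq]; gcongr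

/-- Each rank one operator that is split off uses up at most one unit of rank, so the norm of the
remainder after `k` steps is at least `singularNumber T k`. -/
theorem IsPositiveOperator.exists_sub_sum_rankOne {T : E →L[ℍᵐᵒᵖ] E} (hT : IsPositiveOperator T)
    {ε : ℝ} (hε : 0 < ε) (n : ℕ) :
    ∃ u : ℕ → E, (∀ k < n, singularNumber T k - ε ≤ ‖u k‖ ^ 2) ∧
      IsPositiveOperator (T - ∑ k ∈ Finset.range n, rankOne (u k) (u k)) := by
  induction n with
  | zero => exact ⟨0, by simp, by simpa using hT⟩
  | succ n ih =>
    obtain ⟨u, hu, hpos⟩ := ih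
    obtain ⟨v, hv, hv_pos⟩ := hpos.exists_sub_rankOne (c := singularNumber T n - ε)
      (by linarith [singularNumber_le (T := T) (rank_sum_rankOne_le n u u)])
    have hupdate (k : ℕ) (hk : k < n) : Function.update u n v k = u k :=
      Function.update_of_ne hk.ne v u
    refine ⟨Function.update u n v, fun k hk => ?_, ?_⟩
    · rcases Nat.lt_succ_iff_lt_or_eq.1 hk with hk | rfl
      · rw [hupdate k hk]
        exact hu k hk
      · rwa [Function.update_self]
    · rw [Finset.sum_range_succ, Function.update_self, ← sub_sub,
        Finset.sum_congr rfl fun k hk => by rw [hupdate k (Finset.mem_range.1 hk)]]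
      exact hv_pos

/-! ### Expansions along orthonormal families -/

/-- The orthogonal projection onto the span of the finite subfamily `(e k)`, `k ∈ s`, of an
orthonormal family. -/
def partialProjection {ι : Type*} (e : ι → E) (s : Finset ι) : E →L[ℍᵐᵒᵖ] E :=
  ∑ k ∈ s, rankOne (e k) (e k)

theorem partialProjection_apply {ι : Type*} (e : ι → E) (s : Finset ι) (x : E) :
    partialProjection e s x = ∑ k ∈ s, op ⟪e k, x⟫_ℍ • e k := by
  simp [partialProjection]

theorem sum_inner {ι : Type*} (s : Finset ι) (x : ι → E) (y : E) :
    ⟪∑ k ∈ s, x k, y⟫_ℍ = ∑ k ∈ s, ⟪x k, y⟫_ℍ := by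
  rw [← star_inner, inner_sum, star_sum]
  exact Finset.sum_congr rfl fun k _ => star_inner _ _

theorem inner_partialProjection_left {ι : Type*} (e : ι → E) (s : Finset ι) (x y : E) :
    ⟪partialProjection e s x, y⟫_ℍ = ⟪x, partialProjection e s y⟫_ℍ := by
  simp only [partialProjection_apply, sum_inner, inner_sum, op_smul_inner, inner_op_smul,
    star_inner]

theorem norm_sub_sq (x y : E) : ‖x - y‖ ^ 2 = ‖x‖ ^ 2 - 2 * (⟪x, y⟫_ℍ : ℍ).re + ‖y‖ ^ 2 := by
  have hx : ⟪x, x⟫_ℍ = ⟪x - y, x - y⟫_ℍ + ⟪x, y⟫_ℍ + ⟪y, x⟫_ℍ - ⟪y, y⟫_ℍ := by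
    have h := add_inner (x - y) y x
    rw [sub_add_cancel] at h
    rw [inner_sub, h]
    have h := add_inner (x - y) y y
    rw [sub_add_cancel] at h
    rw [h]
    abel
  have h := congrArg QuaternionAlgebra.re hx
  simp only [Quaternion.re_add, Quaternion.re_sub, re_inner_self] at h
  have hre : (⟪y, x⟫_ℍ : ℍ).re = (⟪x, y⟫_ℍ : ℍ).re := by
    rw [← star_inner, Quaternion.re_star]
  linarith

namespace IsOrthonormalFamily

variable {ι : Type*} [DecidableEq ι] {e : ι → E}

theorem norm_eq_one (he : IsOrthonormalFamily e) (k : ι) : ‖e k‖ = 1 := by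
  have h := re_inner_self (e k)
  rw [he.inner_self_eq_one, Quaternion.re_one] at h
  exact (pow_eq_one_iff_of_nonneg (norm_nonneg _) two_ne_zero).1 h.symm

theorem inner_sum_smul (he : IsOrthonormalFamily e) {s : Finset ι} {j : ι} (hj : j ∈ s)
    (c : ι → ℍ) : ⟪e j, ∑ k ∈ s, op (c k) • e k⟫_ℍ = c j := by
  simp [inner_sum, inner_op_smul, he j, hj]

theorem norm_sq_sum_smul (he : IsOrthonormalFamily e) (s : Finset ι) (c : ι → ℍ) :
    ‖∑ k ∈ s, op (c k) • e k‖ ^ 2 = ∑ k ∈ s, ‖c k‖ ^ 2 := by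
  rw [← re_inner_self, sum_inner, quaternion_re_sum]
  refine Finset.sum_congr rfl fun k hk => ?_
  rw [op_smul_inner, he.inner_sum_smul hk, quaternion_star_mul_self, Quaternion.re_coe]

theorem linearIndependent (he : IsOrthonormalFamily e) : LinearIndependent ℍᵐᵒᵖ e := by
  refine linearIndependent_iff'.2 fun s c hc k hk => ?_
  have h := he.inner_sum_smul hk fun k => (c k).unop
  simp only [op_unop, hc] at h
  rw [← unop_eq_zero_iff, ← h, ← innerCLM_apply, map_zero]

theorem partialProjection_apply_self (he : IsOrthonormalFamily e) {s : Finset ι} {j : ι}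
    (hj : j ∈ s) : partialProjection e s (e j) = e j := by
  rw [partialProjection_apply, Finset.sum_eq_single_of_mem j hj fun k _ hk => by simp [he k, hk],
    he.inner_self_eq_one, op_one, one_smul]

theorem norm_sub_partialProjection_sq (he : IsOrthonormalFamily e) (s : Finset ι) (x : E) :
    ‖x - partialProjection e s x‖ ^ 2 = ‖x‖ ^ 2 - ∑ k ∈ s, ‖⟪e k, x⟫_ℍ‖ ^ 2 := by
  have hinner : (⟪x, partialProjection e s x⟫_ℍ : ℍ).re = ∑ k ∈ s, ‖⟪e k, x⟫_ℍ‖ ^ 2 := by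
    simp only [partialProjection, sum_apply, inner_sum,
      inner_rankOne_apply_self, quaternion_re_sum, Quaternion.re_coe]
  rw [norm_sub_sq, hinner, partialProjection_apply, he.norm_sq_sum_smul]
  ring

theorem sum_norm_inner_sq_le (he : IsOrthonormalFamily e) (s : Finset ι) (x : E) :
    ∑ k ∈ s, ‖⟪e k, x⟫_ℍ‖ ^ 2 ≤ ‖x‖ ^ 2 := by
  rw [← sub_nonneg, ← he.norm_sub_partialProjection_sq]
  positivity

theorem sum_inner_smul_of_mem_span [Fintype ι] (he : IsOrthonormalFamily e) {x : E}
    (hx : x ∈ Submodule.span ℍᵐᵒᵖ (Set.range e)) : ∑ k, op ⟪e k, x⟫_ℍ • e k = x := by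
  obtain ⟨c, rfl⟩ := (Submodule.mem_span_range_iff_exists_fun ℍᵐᵒᵖ).1 hx
  refine Finset.sum_congr rfl fun k _ => ?_
  rw [show ⟪e k, ∑ j, c j • e j⟫_ℍ = (c k).unop from
    he.inner_sum_smul (Finset.mem_univ k) fun k => (c k).unop, op_unop]

theorem eq_zero_of_mem_span [Finite ι] (he : IsOrthonormalFamily e) (x : E)
    (hx : x ∈ Submodule.span ℍᵐᵒᵖ (Set.range e)) (hx0 : ‖x‖ = 0) : x = 0 := by
  have := Fintype.ofFinite ι
  have hinner (k : ι) : ⟪e k, x⟫_ℍ = 0 := by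
    simpa [hx0] using norm_inner_le_norm_mul (e k) x
  simpa [hinner] using (he.sum_inner_smul_of_mem_span hx).symm

/-- Both sides are the trace of the compression of `T` to the common span. -/
theorem sum_re_inner_apply_eq {κ : Type*} [Fintype ι] [Fintype κ] [DecidableEq κ] {y : κ → E}
    (he : IsOrthonormalFamily e) (hy : IsOrthonormalFamily y)
    (hspan : Submodule.span ℍᵐᵒᵖ (Set.range e) = Submodule.span ℍᵐᵒᵖ (Set.range y))
    (T : E →L[ℍᵐᵒᵖ] E) :
    ∑ j, (⟪e j, T (e j)⟫_ℍ : ℍ).re = ∑ k, (⟪y k, T (y k)⟫_ℍ : ℍ).re := by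
  have he_expand (j : ι) : ∑ k, op ⟪y k, e j⟫_ℍ • y k = e j :=
    hy.sum_inner_smul_of_mem_span (hspan ▸ Submodule.subset_span ⟨j, rfl⟩)
  have hy_expand (k : κ) : ∑ j, op ⟪e j, y k⟫_ℍ • e j = y k :=
    he.sum_inner_smul_of_mem_span (hspan ▸ Submodule.subset_span ⟨k, rfl⟩)
  calc ∑ j, (⟪e j, T (e j)⟫_ℍ : ℍ).re
      = ∑ j, ∑ k, (⟪e j, T (y k)⟫_ℍ * ⟪y k, e j⟫_ℍ : ℍ).re := by
        refine Finset.sum_congr rfl fun j _ => ?_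
        simp only [← inner_op_smul, ← map_smul, ← quaternion_re_sum, ← inner_sum, ← map_sum,
          he_expand]
    _ = ∑ k, ∑ j, (⟪y k, e j⟫_ℍ * ⟪e j, T (y k)⟫_ℍ : ℍ).re := by
        rw [Finset.sum_comm]
        simp only [quaternion_re_mul_comm]
    _ = ∑ k, (⟪y k, T (y k)⟫_ℍ : ℍ).re := by
        refine Finset.sum_congr rfl fun k _ => ?_
        simp only [← star_inner (e _) (y k), ← op_smul_inner, ← quaternion_re_sum, ← sum_inner,
          hy_expand]

end IsOrthonormalFamily

/-! ### Ky Fan's inequality -/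

theorem finrank_le_finrank_inf_ker_add {K V V' : Type*} [DivisionRing K] [AddCommGroup V]
    [Module K V] [AddCommGroup V'] [Module K V'] (W : Submodule K V) [FiniteDimensional K W]
    {f : V →ₗ[K] V'} {n : ℕ} (hf : LinearMap.rank f ≤ n) :
    Module.finrank K W ≤ Module.finrank K (W ⊓ LinearMap.ker f : Submodule K V) + n := by
  have hker : Module.finrank K (LinearMap.ker (f.domRestrict W)) =
      Module.finrank K (W ⊓ LinearMap.ker f : Submodule K V) := by
    rw [← Submodule.map_comap_subtype, Submodule.finrank_map_subtype_eq]
    rfl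
  have hrange : Module.finrank K (LinearMap.range (f.domRestrict W)) ≤ n :=
    Module.finrank_le_of_rank_le ((LinearMap.rank_comp_le_left W.subtype f).trans hf)
  have := LinearMap.finrank_range_add_finrank_ker (f.domRestrict W)
  omega

theorem IsOrthonormalFamily.snoc {n : ℕ} {y : Fin n → E} (hy : IsOrthonormalFamily y) {v : E}
    (hv : ‖v‖ = 1) (hvy : ∀ k, ⟪v, y k⟫_ℍ = 0) :
    IsOrthonormalFamily (Fin.snoc y v : Fin (n + 1) → E) := fun j k => by
  have hyv (k : Fin n) : ⟪y k, v⟫_ℍ = 0 := by rw [← star_inner, hvy, star_zero]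
  refine Fin.lastCases ?_ (fun j => ?_) j <;> refine Fin.lastCases ?_ (fun k => ?_) k
  · simp [inner_self_eq, hv]
  · simp [hvy, (Fin.castSucc_lt_last k).ne']
  · simp [hyv, (Fin.castSucc_lt_last j).ne]
  · simp [hy j k]

theorem exists_norm_eq_one_mem_ker {W : Submodule ℍᵐᵒᵖ E} [FiniteDimensional ℍᵐᵒᵖ W]
    (hW : ∀ x ∈ W, ‖x‖ = 0 → x = 0) {n : ℕ} (hn : n < Module.finrank ℍᵐᵒᵖ W) {G : E →L[ℍᵐᵒᵖ] E}
    (hG : LinearMap.rank (G : E →ₗ[ℍᵐᵒᵖ] E) ≤ n) : ∃ v ∈ W, ‖v‖ = 1 ∧ G v = 0 := by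
  have hne : W ⊓ LinearMap.ker (G : E →ₗ[ℍᵐᵒᵖ] E) ≠ ⊥ := fun h => by
    have := finrank_le_finrank_inf_ker_add W hG
    rw [h, finrank_bot] at this
    omega
  obtain ⟨x, ⟨hxW, hxG⟩, hx⟩ := Submodule.exists_mem_ne_zero_of_ne_bot hne
  refine ⟨op ((‖x‖⁻¹ : ℝ) : ℍ) • x, W.smul_mem _ hxW, ?_, ?_⟩
  · rw [norm_op_smul, Quaternion.norm_coe, norm_inv, norm_norm,
      inv_mul_cancel₀ fun h => hx (hW x hxW h)]
  · rw [map_smul, show G x = 0 from hxG, smul_zero]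

theorem exists_isOrthonormalFamily_mem_ker {N : ℕ} {W : Submodule ℍᵐᵒᵖ E}
    [FiniteDimensional ℍᵐᵒᵖ W] (hW : ∀ x ∈ W, ‖x‖ = 0 → x = 0) (hN : N ≤ Module.finrank ℍᵐᵒᵖ W)
    {G : ℕ → E →L[ℍᵐᵒᵖ] E} (hG : ∀ n, LinearMap.rank (G n : E →ₗ[ℍᵐᵒᵖ] E) ≤ n) :
    ∃ y : Fin N → E, IsOrthonormalFamily y ∧ ∀ k, y k ∈ W ∧ G k (y k) = 0 := by
  induction N generalizing W with
  | zero => exact ⟨Fin.elim0, fun j => j.elim0, fun k => k.elim0⟩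
  | succ N ih =>
    obtain ⟨v, hvW, hv, hGv⟩ := exists_norm_eq_one_mem_ker hW hN (hG N)
    have hfinrank := finrank_le_finrank_inf_ker_add W (n := 1)
      (by simpa using rank_rankOne_le_one v v)
    obtain ⟨y, hy, hyG⟩ := ih (W := W ⊓ LinearMap.ker (rankOne v v : E →ₗ[ℍᵐᵒᵖ] E))
      (fun x hx => hW x hx.1) (by omega)
    have hvy (k : Fin N) : ⟪v, y k⟫_ℍ = 0 := by
      have h : rankOne v v (y k) = 0 := (hyG k).1.2
      rw [← norm_eq_zero, ← mul_one ‖_‖, ← hv, ← norm_op_smul, ← rankOne_apply, h, norm_zero]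
    refine ⟨Fin.snoc y v, hy.snoc hv hvy, Fin.lastCases ?_ fun k => ?_⟩
    · simpa using ⟨hvW, hGv⟩
    · simpa using ⟨(hyG k).1.1, (hyG k).2⟩

theorem IsOrthonormalFamily.re_inner_apply_le_operatorNorm {ι : Type*} [DecidableEq ι] {y : ι → E}
    (hy : IsOrthonormalFamily y) (T : E →L[ℍᵐᵒᵖ] E) (k : ι) :
    (⟪y k, T (y k)⟫_ℍ : ℍ).re ≤ operatorNorm T :=
  calc (⟪y k, T (y k)⟫_ℍ : ℍ).re ≤ ‖y k‖ * ‖T (y k)‖ :=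
        (quaternion_re_le_norm _).trans (norm_inner_le_norm_mul _ _)
    _ ≤ ‖y k‖ * (operatorNorm T * ‖y k‖) := by
        gcongr
        exact norm_apply_le_operatorNorm_mul T _
    _ = operatorNorm T := by rw [hy.norm_eq_one, one_mul, mul_one]

/-- Ky Fan's inequality. The trace of `T` on the span of the `e k` is computed in an orthonormal
basis adapted to nearly optimal approximations `G k` of `T` of rank `k`. -/
theorem IsOrthonormalFamily.sum_re_inner_apply_le {e : ℕ → E} (he : IsOrthonormalFamily e)
    (T : E →L[ℍᵐᵒᵖ] E) (N : ℕ) :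
    ∑ k ∈ Finset.range N, (⟪e k, T (e k)⟫_ℍ : ℍ).re ≤
      ∑ k ∈ Finset.range N, singularNumber T k := by
  rw [Finset.sum_range, Finset.sum_range]
  refine le_of_forall_pos_le_add fun ε hε => ?_
  obtain ⟨δ, hδ, hNδ⟩ := exists_pos_mul_lt hε (N : ℝ)
  choose G hG hG_lt using fun k =>
    exists_operatorNorm_sub_lt (lt_add_of_pos_right (singularNumber T k) hδ)
  have heN : IsOrthonormalFamily fun k : Fin N => e k := he.comp Fin.val_injective
  have := FiniteDimensional.span_of_finite ℍᵐᵒᵖ (Set.finite_range fun k : Fin N => e k)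
  have hfinrank := finrank_span_eq_card heN.linearIndependent
  rw [Fintype.card_fin] at hfinrank
  obtain ⟨y, hy, hyG⟩ := exists_isOrthonormalFamily_mem_ker heN.eq_zero_of_mem_span
    hfinrank.ge hG
  have hspan : Submodule.span ℍᵐᵒᵖ (Set.range y) =
      Submodule.span ℍᵐᵒᵖ (Set.range fun k : Fin N => e k) :=
    Submodule.eq_of_le_of_finrank_le
      (Submodule.span_le.2 (Set.range_subset_iff.2 fun k => (hyG k).1))
      (by rw [hfinrank, finrank_span_eq_card hy.linearIndependent, Fintype.card_fin])
  calc ∑ k : Fin N, (⟪e k, T (e k)⟫_ℍ : ℍ).re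
      = ∑ k : Fin N, (⟪y k, (T - G k) (y k)⟫_ℍ : ℍ).re := by
        simp only [sub_apply, (hyG _).2, sub_zero, heN.sum_re_inner_apply_eq hy hspan.symm]
    _ ≤ ∑ k : Fin N, (singularNumber T k + δ) :=
        Finset.sum_le_sum fun k _ => (hy.re_inner_apply_le_operatorNorm _ k).trans (hG_lt k).le
    _ ≤ ∑ k : Fin N, singularNumber T k + ε := by
        rw [Finset.sum_add_distrib, Finset.sum_const, Finset.card_fin, nsmul_eq_mul]
        gcongr

/-! ### Parseval frames and the trace formula -/

theorem continuous_inner_apply_self (T : E →L[ℍᵐᵒᵖ] E) : Continuous fun x => ⟪x, T x⟫_ℍ := by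
  refine continuous_iff_continuousAt.2 fun a => tendsto_iff_norm_sub_tendsto_zero.2 ?_
  have hbound : Tendsto (fun x => ‖x - a‖ * ‖T x‖ + ‖a‖ * ‖T x - T a‖) (𝓝 a) (𝓝 0) := by
    have : Continuous fun x => ‖x - a‖ * ‖T x‖ + ‖a‖ * ‖T x - T a‖ := by fun_prop
    simpa using this.tendsto a
  refine squeeze_zero (fun _ => norm_nonneg _) (fun x => ?_) hbound
  have hsplit : ⟪x, T x⟫_ℍ - ⟪a, T a⟫_ℍ = ⟪x - a, T x⟫_ℍ + ⟪a, T x - T a⟫_ℍ := by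
    have h := add_inner (x - a) a (T x)
    rw [sub_add_cancel] at h
    rw [inner_sub, h]
    abel
  rw [hsplit]
  exact (norm_add_le _ _).trans
    (add_le_add (norm_inner_le_norm_mul _ _) (norm_inner_le_norm_mul _ _))

namespace IsParsevalFrame

variable {X : Type*} [MeasurableSpace X] {k : X → E} {ν : Measure X}

theorem lintegral_re_inner_partialProjection (hk : IsParsevalFrame k ν) {ι : Type*}
    [DecidableEq ι] {e : ι → E} (he : IsOrthonormalFamily e) {T : E →L[ℍᵐᵒᵖ] E}
    (hT : IsPositiveOperator T) (s : Finset ι) :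
    AEMeasurable (fun x => ENNReal.ofReal
      (⟪partialProjection e s (k x), T (partialProjection e s (k x))⟫_ℍ : ℍ).re) ν ∧
    ∫⁻ x, ENNReal.ofReal
        (⟪partialProjection e s (k x), T (partialProjection e s (k x))⟫_ℍ : ℍ).re ∂ν =
      ENNReal.ofReal (∑ j ∈ s, (⟪e j, T (e j)⟫_ℍ : ℍ).re) := by
  have hsum (y : E) : (⟪partialProjection e s y, T (partialProjection e s y)⟫_ℍ : ℍ).re =
      ∑ j ∈ s, (⟪e j, y⟫_ℍ * ⟪y, partialProjection e s (T (e j))⟫_ℍ : ℍ).re := by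
    conv_lhs => rw [partialProjection_apply e s y, map_sum, ← partialProjection_apply, inner_sum]
    rw [quaternion_re_sum]
    refine Finset.sum_congr rfl fun j _ => ?_
    rw [map_smul, inner_op_smul, quaternion_re_mul_comm, inner_partialProjection_left]
  have hintegrable (j : ι) := hk.integrable_re (e j) (partialProjection e s (T (e j)))
  have hfun := integrable_finsetSum s fun j _ => hintegrable j
  simp only [← hsum] at hfun
  refine ⟨hfun.aestronglyMeasurable.aemeasurable.ennreal_ofReal, ?_⟩
  rw [← ofReal_integral_eq_lintegral_ofReal hfun (Eventually.of_forall fun x => (hT _).2)]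
  simp only [hsum]
  rw [integral_finsetSum _ fun j _ => hintegrable j]
  congr 1
  refine Finset.sum_congr rfl fun j hj => ?_
  rw [hk.integral_re, ← inner_partialProjection_left, he.partialProjection_apply_self hj]

theorem lintegral_re_inner_le (hk : IsParsevalFrame k ν) {T : E →L[ℍᵐᵒᵖ] E}
    (hT : IsPositiveOperator T) {e : ℕ → E} (he : IsOrthonormalFamily e)
    (hke : ∀ᵐ x ∂ν, Tendsto (fun N => partialProjection e (Finset.range N) (k x)) atTop (𝓝 (k x))) :
    ∫⁻ x, ENNReal.ofReal (⟪k x, T (k x)⟫_ℍ : ℍ).re ∂ν ≤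
      ∑' n, ENNReal.ofReal (singularNumber T n) := by
  let P (N : ℕ) := partialProjection e (Finset.range N)
  calc ∫⁻ x, ENNReal.ofReal (⟪k x, T (k x)⟫_ℍ : ℍ).re ∂ν
      = ∫⁻ x, liminf (fun N => ENNReal.ofReal (⟪P N (k x), T (P N (k x))⟫_ℍ : ℍ).re) atTop ∂ν := by
        refine lintegral_congr_ae (hke.mono fun x hx => (Tendsto.liminf_eq ?_).symm)
        have hcont := Quaternion.continuous_re.comp (continuous_inner_apply_self T)
        exact ENNReal.tendsto_ofReal ((hcont.tendsto (k x)).comp hx)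
    _ ≤ liminf (fun N => ∫⁻ x, ENNReal.ofReal (⟪P N (k x), T (P N (k x))⟫_ℍ : ℍ).re ∂ν) atTop :=
        lintegral_liminf_le' fun N => (hk.lintegral_re_inner_partialProjection he hT _).1
    _ ≤ ∑' n, ENNReal.ofReal (singularNumber T n) := by
        refine liminf_le_of_le (h := fun b hb => ?_)
        obtain ⟨N, hN⟩ := hb.exists
        refine hN.trans ?_
        rw [(hk.lintegral_re_inner_partialProjection he hT _).2]
        calc _ ≤ ENNReal.ofReal (∑ j ∈ Finset.range N, singularNumber T j) :=
              ENNReal.ofReal_le_ofReal (he.sum_re_inner_apply_le T N)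
          _ = ∑ j ∈ Finset.range N, ENNReal.ofReal (singularNumber T j) :=
              ENNReal.ofReal_sum_of_nonneg fun j _ => singularNumber_nonneg T j
          _ ≤ _ := ENNReal.sum_le_tsum _

theorem ofReal_sum_norm_sq_le (hk : IsParsevalFrame k ν) {T : E →L[ℍᵐᵒᵖ] E} {u : ℕ → E} {N : ℕ}
    (hu : IsPositiveOperator (T - ∑ j ∈ Finset.range N, rankOne (u j) (u j))) :
    ENNReal.ofReal (∑ j ∈ Finset.range N, ‖u j‖ ^ 2) ≤
      ∫⁻ x, ENNReal.ofReal (⟪k x, T (k x)⟫_ℍ : ℍ).re ∂ν := by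
  have hsq (j : ℕ) (x : X) : (⟪u j, k x⟫_ℍ * ⟪k x, u j⟫_ℍ : ℍ).re = ‖⟪u j, k x⟫_ℍ‖ ^ 2 := by
    rw [← star_inner (u j), quaternion_self_mul_star, Quaternion.re_coe]
  have hintegrable (j : ℕ) : Integrable (fun x => ‖⟪u j, k x⟫_ℍ‖ ^ 2) ν := by
    simpa only [hsq] using hk.integrable_re (u j) (u j)
  calc ENNReal.ofReal (∑ j ∈ Finset.range N, ‖u j‖ ^ 2)
      = ENNReal.ofReal (∫ x, ∑ j ∈ Finset.range N, ‖⟪u j, k x⟫_ℍ‖ ^ 2 ∂ν) := by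
        rw [integral_finsetSum _ fun j _ => hintegrable j]
        simp only [← hsq, hk.integral_re, re_inner_self]
    _ = ∫⁻ x, ENNReal.ofReal (∑ j ∈ Finset.range N, ‖⟪u j, k x⟫_ℍ‖ ^ 2) ∂ν :=
        ofReal_integral_eq_lintegral_ofReal (integrable_finsetSum _ fun j _ => hintegrable j)
          (Eventually.of_forall fun x => Finset.sum_nonneg fun j _ => sq_nonneg _)
    _ ≤ ∫⁻ x, ENNReal.ofReal (⟪k x, T (k x)⟫_ℍ : ℍ).re ∂ν := by
        refine lintegral_mono fun x => ENNReal.ofReal_le_ofReal ?_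
        have h := (hu (k x)).2
        simpa only [sub_apply, sum_apply, inner_sub, inner_sum, inner_rankOne_apply_self,
          Quaternion.re_sub, quaternion_re_sum, Quaternion.re_coe, sub_nonneg] using h

theorem tsum_singularNumber_le (hk : IsParsevalFrame k ν) {T : E →L[ℍᵐᵒᵖ] E}
    (hT : IsPositiveOperator T) :
    ∑' n, ENNReal.ofReal (singularNumber T n) ≤
      ∫⁻ x, ENNReal.ofReal (⟪k x, T (k x)⟫_ℍ : ℍ).re ∂ν := by
  refine ENNReal.tsum_le_of_sum_range_le fun N => ?_
  refine ENNReal.le_of_forall_pos_le_add fun ε hε _ => ?_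
  obtain ⟨δ, hδ, hNδ⟩ := exists_pos_mul_lt (NNReal.coe_pos.2 hε) (N : ℝ)
  obtain ⟨u, hu, hpos⟩ := hT.exists_sub_sum_rankOne hδ N
  calc ∑ n ∈ Finset.range N, ENNReal.ofReal (singularNumber T n)
      = ENNReal.ofReal (∑ n ∈ Finset.range N, singularNumber T n) :=
        (ENNReal.ofReal_sum_of_nonneg fun n _ => singularNumber_nonneg T n).symm
    _ ≤ ENNReal.ofReal (∑ n ∈ Finset.range N, ‖u n‖ ^ 2 + ε) := by
        refine ENNReal.ofReal_le_ofReal ?_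
        have h := Finset.sum_le_sum fun n hn => hu n (Finset.mem_range.1 hn)
        rw [Finset.sum_sub_distrib, Finset.sum_const, Finset.card_range, nsmul_eq_mul] at h
        linarith
    _ ≤ ENNReal.ofReal (∑ n ∈ Finset.range N, ‖u n‖ ^ 2) + ε :=
        ENNReal.ofReal_add_le.trans (by rw [ENNReal.ofReal_coe_nnreal])
    _ ≤ _ := by gcongr; exact hk.ofReal_sum_norm_sq_le hpos

theorem tsum_singularNumber_eq (hk : IsParsevalFrame k ν) {T : E →L[ℍᵐᵒᵖ] E}
    (hT : IsPositiveOperator T) {e : ℕ → E} (he : IsOrthonormalFamily e)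
    (hke : ∀ᵐ x ∂ν, Tendsto (fun N => partialProjection e (Finset.range N) (k x)) atTop (𝓝 (k x))) :
    ∑' n, ENNReal.ofReal (singularNumber T n) =
      ∫⁻ x, ENNReal.ofReal (⟪k x, T (k x)⟫_ℍ : ℍ).re ∂ν :=
  (hk.tsum_singularNumber_le hT).antisymm (hk.lintegral_re_inner_le hT he hke)

end IsParsevalFrame

/-! ### Singular value decompositions -/

theorem norm_sum_smul_le {ι : Type*} [DecidableEq ι] {e σ : ι → E} (he : IsOrthonormalFamily e)
    (hσ : IsOrthonormalFamily σ) {s : ι → ℝ} (hs : ∀ k, 0 ≤ s k) {c : ℝ} (hc : 0 ≤ c)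
    {t : Finset ι} (hsc : ∀ k ∈ t, s k ≤ c) (x : E) :
    ‖∑ k ∈ t, op ((s k : ℍ) * ⟪e k, x⟫_ℍ) • σ k‖ ≤ c * ‖x‖ := by
  refine le_of_sq_le_sq ?_ (by positivity)
  rw [hσ.norm_sq_sum_smul, mul_pow]
  calc ∑ k ∈ t, ‖(s k : ℍ) * ⟪e k, x⟫_ℍ‖ ^ 2 ≤ ∑ k ∈ t, c ^ 2 * ‖⟪e k, x⟫_ℍ‖ ^ 2 := by
        refine Finset.sum_le_sum fun k hk => ?_
        rw [norm_mul, mul_pow, Quaternion.norm_coe, Real.norm_of_nonneg (hs k)]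
        have := hs k
        gcongr
        exact hsc k hk
    _ ≤ c ^ 2 * ‖x‖ ^ 2 := by
        rw [← Finset.mul_sum]
        gcongr
        exact he.sum_norm_inner_sq_le t x

theorem singularNumber_le_of_hasSum {T : E →L[ℍᵐᵒᵖ] E} {s : ℕ → ℝ} (hs : ∀ k, 0 ≤ s k)
    (hanti : Antitone s) {e σ : ℕ → E} (he : IsOrthonormalFamily e) (hσ : IsOrthonormalFamily σ)
    (hT : ∀ x, HasSum (fun k => op ((s k : ℍ) * ⟪e k, x⟫_ℍ) • σ k) (T x)) (n : ℕ) :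
    singularNumber T n ≤ s n := by
  let F : E →L[ℍᵐᵒᵖ] E := ∑ k ∈ Finset.range n, rankOne (op (s k : ℍ) • σ k) (e k)
  have hF (x : E) : F x = ∑ k ∈ Finset.range n, op ((s k : ℍ) * ⟪e k, x⟫_ℍ) • σ k := by
    simp only [F, sum_apply, rankOne_apply, smul_smul, ← op_mul]
  refine (singularNumber_le (F := F) (rank_sum_rankOne_le n _ e)).trans
    (operatorNorm_le_of_bound (hs n) fun x => ?_)
  refine le_of_tendsto (((hT x).tendsto_sum_nat.sub_const (F x)).norm)
    ((eventually_ge_atTop n).mono fun N hN => ?_)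
  rw [hF, ← Finset.sum_Ico_eq_sub _ hN]
  exact norm_sum_smul_le he hσ hs (hs n) (fun k hk => hanti (Finset.mem_Ico.1 hk).1) x

theorem inner_apply_eq_of_hasSum {T : E →L[ℍᵐᵒᵖ] E} {s : ℕ → ℝ} {e σ : ℕ → E}
    (hσ : IsOrthonormalFamily σ)
    (hT : ∀ x, HasSum (fun k => op ((s k : ℍ) * ⟪e k, x⟫_ℍ) • σ k) (T x)) (x : E) (k : ℕ) :
    ⟪σ k, T x⟫_ℍ = s k * ⟪e k, x⟫_ℍ := by
  have h := (hT x).mapL (innerCLM (σ k))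
  refine h.unique ?_
  convert hasSum_single k fun j hj => ?_ using 1
  · rw [innerCLM_apply, inner_op_smul, hσ.inner_self_eq_one, one_mul]
  · rw [innerCLM_apply, inner_op_smul, hσ, if_neg hj.symm, zero_mul]

theorem le_singularNumber_of_hasSum {T : E →L[ℍᵐᵒᵖ] E} {s : ℕ → ℝ} (hs : ∀ k, 0 ≤ s k)
    (hanti : Antitone s) {e σ : ℕ → E} (he : IsOrthonormalFamily e) (hσ : IsOrthonormalFamily σ)
    (hT : ∀ x, HasSum (fun k => op ((s k : ℍ) * ⟪e k, x⟫_ℍ) • σ k) (T x)) (n : ℕ) :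
    s n ≤ singularNumber T n := by
  have he' := he.comp (Fin.val_injective (n := n + 1))
  have hσ' := hσ.comp (Fin.val_injective (n := n + 1))
  have := FiniteDimensional.span_of_finite ℍᵐᵒᵖ (Set.finite_range (e ∘ Fin.val (n := n + 1)))
  refine le_singularNumber fun F hF => ?_
  obtain ⟨v, hv, hv1, hFv⟩ := exists_norm_eq_one_mem_ker he'.eq_zero_of_mem_span
    (by rw [finrank_span_eq_card he'.linearIndependent, Fintype.card_fin]; exact n.lt_succ_self) hF
  have hTv : s n ≤ ‖T v‖ := by
    refine le_of_sq_le_sq ?_ (norm_nonneg _)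
    calc s n ^ 2 = s n ^ 2 * ∑ k, ‖⟪(e ∘ Fin.val) k, v⟫_ℍ‖ ^ 2 := by
          rw [← he'.norm_sq_sum_smul, he'.sum_inner_smul_of_mem_span hv, hv1, one_pow, mul_one]
      _ ≤ ∑ k, ‖⟪(σ ∘ Fin.val) k, T v⟫_ℍ‖ ^ 2 := by
          rw [Finset.mul_sum]
          refine Finset.sum_le_sum fun k _ => ?_
          rw [Function.comp_apply, Function.comp_apply, inner_apply_eq_of_hasSum hσ hT, norm_mul,
            mul_pow, Quaternion.norm_coe, Real.norm_of_nonneg (hs k)]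
          have := hs n
          gcongr
          exact hanti k.is_le
      _ ≤ ‖T v‖ ^ 2 := hσ'.sum_norm_inner_sq_le _ _
  calc s n ≤ ‖(T - F) v‖ := by rwa [sub_apply, hFv, sub_zero]
    _ ≤ operatorNorm (T - F) * ‖v‖ := norm_apply_le_operatorNorm_mul _ _
    _ = operatorNorm (T - F) := by rw [hv1, mul_one]

theorem IsSingularValueSeq.singularNumber_eq {T : E →L[ℍᵐᵒᵖ] E} {s : ℕ → ℝ}
    (h : IsSingularValueSeq T s) (n : ℕ) : singularNumber T n = s n :=
  let ⟨hs, hanti, _, _, he, hσ, hT⟩ := h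
  (singularNumber_le_of_hasSum hs hanti he hσ hT n).antisymm
    (le_singularNumber_of_hasSum hs hanti he hσ hT n)

end InnerProduct
/-! ### Slices -/

theorem imaginaryUnits_mul_self {J : ℍ} (hJ : J ∈ imaginaryUnits) : J * J = -1 := by
  have hstar : star J = -J := QuaternionAlgebra.star_eq_neg.2 hJ.1
  have h := quaternion_star_mul_self J
  rw [hstar, hJ.2, one_pow, Quaternion.coe_one, neg_mul] at h
  exact neg_eq_iff_eq_neg.1 h

theorem imaginaryUnits_nonempty : imaginaryUnits.Nonempty := by
  refine ⟨(Complex.I : ℍ), rfl, (pow_eq_one_iff_of_nonneg (norm_nonneg _) two_ne_zero).1 ?_⟩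
  rw [sq, ← Quaternion.normSq_eq_norm_mul_self, Quaternion.normSq_def']
  simp

section Slice

variable {J : imaginaryUnits}

/-- The embedding `x₀ + x₁ √-1 ↦ x₀ + J x₁` of `ℂ` onto the slice `ℂ_J`, as a homomorphism of
real algebras. -/
def sliceHom (J : imaginaryUnits) : ℂ →ₐ[ℝ] ℍ :=
  Complex.lift ⟨J, imaginaryUnits_mul_self J.2⟩

theorem sliceHom_apply (z : ℂ) : sliceHom J z = slicePoint J z := by
  rw [sliceHom, Complex.lift_apply, Complex.liftAux_apply, slicePoint, ← Quaternion.coe_commutes,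
    Quaternion.coe_mul_eq_smul]
  rfl

theorem slicePoint_mul (z w : ℂ) : slicePoint J (z * w) = slicePoint J z * slicePoint J w := by
  simp only [← sliceHom_apply, map_mul]

theorem slicePoint_pow (z : ℂ) (n : ℕ) : slicePoint J (z ^ n) = slicePoint J z ^ n := by
  simp only [← sliceHom_apply, map_pow]

theorem slicePoint_ofReal (r : ℝ) : slicePoint J r = (r : ℍ) := by
  simp [slicePoint]

theorem star_slicePoint (z : ℂ) : star (slicePoint J z) = slicePoint J (star z) := by
  have := J.2.1
  ext <;> simp [slicePoint, this, mul_comm]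

theorem norm_slicePoint (z : ℂ) : ‖slicePoint J z‖ = ‖z‖ := by
  have h : (((‖slicePoint J z‖ ^ 2 : ℝ) : ℍ)) = ((‖z‖ ^ 2 : ℝ) : ℍ) := by
    rw [← quaternion_star_mul_self, star_slicePoint, ← slicePoint_mul, ← slicePoint_ofReal (J := J),
      Complex.ofReal_pow, ← Complex.conj_mul', Complex.star_def]
  exact (pow_left_inj₀ (norm_nonneg _) (norm_nonneg _) two_ne_zero).1 (Quaternion.coe_injective h)

/-- The embedding of `ℂ` onto the slice `ℂ_J` as a real continuous linear map. -/
def sliceCLM (J : imaginaryUnits) : ℂ →L[ℝ] ℍ :=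
  LinearMap.toContinuousLinearMap (sliceHom J).toLinearMap

theorem sliceCLM_apply (z : ℂ) : sliceCLM J z = slicePoint J z := sliceHom_apply z

theorem continuous_slicePoint : Continuous (slicePoint J) :=
  (sliceCLM J).continuous.congr sliceCLM_apply

theorem slicePoint_mem_unitBall {z : ℂ} :
    slicePoint J z ∈ unitBall ↔ z ∈ Metric.ball (0 : ℂ) 1 := by
  rw [unitBall, mem_ball_zero_iff, mem_ball_zero_iff, norm_slicePoint]

end Slice

theorem profile_unitBall : profile unitBall = Metric.ball 0 1 := by
  obtain ⟨I, hI⟩ := imaginaryUnits_nonempty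
  ext z
  exact ⟨fun ⟨J, hJ, h⟩ => (slicePoint_mem_unitBall (J := ⟨J, hJ⟩)).1 h,
    fun h => ⟨I, hI, (slicePoint_mem_unitBall (J := ⟨I, hI⟩)).2 h⟩⟩

/-! ### Stem functions -/

section Stem

variable {J : imaginaryUnits} {f : ℍ → ℍ} {a b : ℂ → ℍ} {z : ℂ}

/-- The complexification `ℍ ⊗ ℂ = ℍ + √-1 ℍ`, written in the coordinates of `ℍ`. The components
`a`, `b` of a slice function are the real and imaginary parts of its stem function
`a + √-1 b : ℂ → ℍ ⊗ ℂ`, and the Cauchy-Riemann system says that the stem function is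
holomorphic. -/
abbrev StemSpace : Type := Fin 4 → ℂ

/-- The real linear isomorphism of `ℍ` with its space of coordinates. -/
def quaternionCoords : ℍ ≃ₗ[ℝ] Fin 4 → ℝ :=
  QuaternionAlgebra.linearEquivTuple (-1) 0 (-1)

/-- The inclusion `ℍ → ℍ + √-1 ℍ`. -/
def toStem : ℍ →L[ℝ] StemSpace :=
  LinearMap.toContinuousLinearMap
    (Complex.ofRealCLM.toLinearMap.compLeft (Fin 4) ∘ₗ quaternionCoords.toLinearMap)

/-- The real part `ℍ + √-1 ℍ → ℍ`. -/
def stemRe : StemSpace →L[ℝ] ℍ :=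
  LinearMap.toContinuousLinearMap
    (quaternionCoords.symm.toLinearMap ∘ₗ Complex.reLm.compLeft (Fin 4))

/-- The imaginary part `ℍ + √-1 ℍ → ℍ`. -/
def stemIm : StemSpace →L[ℝ] ℍ :=
  LinearMap.toContinuousLinearMap
    (quaternionCoords.symm.toLinearMap ∘ₗ Complex.imLm.compLeft (Fin 4))

theorem stemRe_apply (v : StemSpace) :
    stemRe v = quaternionCoords.symm fun k => (v k).re := rfl

theorem stemIm_apply (v : StemSpace) :
    stemIm v = quaternionCoords.symm fun k => (v k).im := rfl

theorem stemRe_toStem (q : ℍ) : stemRe (toStem q) = q :=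
  quaternionCoords.symm_apply_apply q

theorem stemIm_toStem (q : ℍ) : stemIm (toStem q) = 0 :=
  map_zero quaternionCoords.symm

theorem stemRe_smul (z : ℂ) (v : StemSpace) :
    stemRe (z • v) = z.re • stemRe v - z.im • stemIm v := by
  simp only [stemRe_apply, stemIm_apply, ← map_smul, ← map_sub]
  exact congrArg quaternionCoords.symm (funext fun k => Complex.mul_re z (v k))

theorem stemIm_smul (z : ℂ) (v : StemSpace) :
    stemIm (z • v) = z.re • stemIm v + z.im • stemRe v := by
  simp only [stemRe_apply, stemIm_apply, ← map_smul, ← map_add]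
  exact congrArg quaternionCoords.symm (funext fun k => Complex.mul_im z (v k))

/-- The evaluation `a + √-1 b ↦ a + J b` of the complexification of `ℍ`. -/
def stemEval (J : ℍ) : StemSpace →L[ℝ] ℍ :=
  stemRe + (ContinuousLinearMap.mul ℝ ℍ J).comp stemIm

theorem stemEval_apply (J : ℍ) (v : StemSpace) : stemEval J v = stemRe v + J * stemIm v := rfl

theorem stemEval_toStem (J q : ℍ) : stemEval J (toStem q) = q := by
  rw [stemEval_apply, stemRe_toStem, stemIm_toStem, mul_zero, add_zero]

theorem stemEval_smul (z : ℂ) (v : StemSpace) :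
    stemEval J (z • v) = slicePoint J z * stemEval J v := by
  have hJ : ∀ q : ℍ, (J : ℍ) * (J * q) = -q := fun q => by
    rw [← mul_assoc, imaginaryUnits_mul_self J.2, neg_one_mul]
  simp only [stemEval_apply, stemRe_smul, stemIm_smul, slicePoint, mul_add, add_mul, mul_assoc,
    Quaternion.coe_mul_eq_smul, mul_smul_comm, hJ]
  module

theorem differentiableAt_stem (ha : DifferentiableAt ℝ a z) (hb : DifferentiableAt ℝ b z)
    (hab : fderiv ℝ a z 1 = fderiv ℝ b z Complex.I)
    (hba : fderiv ℝ b z 1 = -fderiv ℝ a z Complex.I) :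
    DifferentiableAt ℂ (fun w => toStem (a w) + Complex.I • toStem (b w)) z := by
  have hderiv : HasFDerivAt (fun w => toStem (a w) + Complex.I • toStem (b w))
      (toStem ∘SL fderiv ℝ a z + Complex.I • (toStem ∘SL fderiv ℝ b z)) z :=
    (toStem.hasFDerivAt.comp z ha.hasFDerivAt).add
      ((toStem.hasFDerivAt.comp z hb.hasFDerivAt).const_smul Complex.I)
  refine differentiableAt_complex_iff_differentiableAt_real.2 ⟨hderiv.differentiableAt, ?_⟩
  have hI : fderiv ℝ a z Complex.I = -fderiv ℝ b z 1 := by rw [hba, neg_neg]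
  rw [hderiv.fderiv]
  simp only [add_apply, smul_apply, ContinuousLinearMap.comp_apply, ← hab, hI, map_neg, smul_add,
    smul_smul, Complex.I_mul_I, neg_smul, one_smul]
  exact add_comm _ _

theorem IsLeftSliceHyperholomorphic.exists_hasSum
    (hf : IsLeftSliceHyperholomorphic unitBall f) (J : imaginaryUnits) :
    ∃ c : ℕ → ℍ, ∀ z ∈ Metric.ball (0 : ℂ) 1,
      HasSum (fun n => slicePoint J (z ^ n) * c n) (f (slicePoint J z)) := by
  obtain ⟨-, a, b, hab, -, hd, hcr⟩ := hf
  rw [profile_unitBall] at hd hcr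
  set G : ℂ → StemSpace := fun w => toStem (a w) + Complex.I • toStem (b w) with hG
  have hGd : DifferentiableOn ℂ G (Metric.ball 0 1) := fun z hz =>
    (differentiableAt_stem (hd z hz).1 (hd z hz).2 (hcr z hz).1
      (hcr z hz).2).differentiableWithinAt
  refine ⟨fun n => stemEval J ((n.factorial : ℂ)⁻¹ • iteratedDeriv n G 0), fun z hz => ?_⟩
  have hsum := (stemEval J).hasSum (Complex.hasSum_taylorSeries_on_ball hGd hz)
  have hz' := (slicePoint_mem_unitBall (J := J)).2 hz
  have hfG : stemEval J (G z) = f (slicePoint J z) := by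
    rw [hab J J.2 z hz', hG, map_add, stemEval_smul, stemEval_toStem, stemEval_toStem]
    simp [slicePoint]
  rw [hfG] at hsum
  refine hsum.congr_fun fun n => ?_
  rw [← stemEval_smul, smul_comm, sub_zero]

end Stem

/-! ### Power series -/

/-- The coefficients `c` of power series `∑ qⁿ c_n` that converge in the unit ball. -/
def IsPowerSeriesCoeff (c : ℕ → ℍ) : Prop :=
  ∀ r : ℝ, 0 ≤ r → r < 1 → Summable fun n => ‖c n‖ * r ^ n

/-- The sum `∑ qⁿ c_n` of a power series in the unit ball, extended by zero. -/
def powerSum (c : ℕ → ℍ) : ℍ → ℍ := unitBall.indicator fun q => ∑' n, q ^ n * c n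

/-- The power series `∑ qⁿ c_n` as a formal multilinear series. -/
def powerFormalSeries (c : ℕ → ℍ) : FormalMultilinearSeries ℝ ℍ ℍ := fun n =>
  (mulRight (c n)).compContinuousMultilinearMap (ContinuousMultilinearMap.mkPiAlgebraFin ℝ n ℍ)

/-- The stem function `∑ zⁿ c_n` of a power series. -/
def powerStem (c : ℕ → ℍ) (z : ℂ) : StemSpace := ∑' n, z ^ n • toStem (c n)

section PowerSeries

variable {J : imaginaryUnits} {c : ℕ → ℍ} {z : ℂ}

theorem powerSum_eq_zero {q : ℍ} (hq : q ∉ unitBall) : powerSum c q = 0 :=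
  Set.indicator_of_notMem hq _

theorem IsPowerSeriesCoeff.hasSum (hc : IsPowerSeriesCoeff c) (hz : z ∈ Metric.ball (0 : ℂ) 1) :
    HasSum (fun n => slicePoint J (z ^ n) * c n) (powerSum c (slicePoint J z)) := by
  rw [powerSum, Set.indicator_of_mem (slicePoint_mem_unitBall.2 hz)]
  simp only [← slicePoint_pow]
  rw [mem_ball_zero_iff] at hz
  refine (Summable.of_norm_bounded (hc ‖z‖ (norm_nonneg z) hz) fun n => ?_).hasSum
  rw [norm_mul, norm_slicePoint, norm_pow, mul_comm]

theorem norm_powerFormalSeries_le (c : ℕ → ℍ) (n : ℕ) : ‖powerFormalSeries c n‖ ≤ ‖c n‖ := by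
  refine ContinuousMultilinearMap.opNorm_le_bound (norm_nonneg _) fun m => ?_
  have hprod : ‖(List.ofFn m).prod‖ = ∏ k, ‖m k‖ := by
    rw [← List.prod_ofFn]
    exact (map_list_prod (normHom (α := ℍ)) _).trans (by rw [List.map_ofFn]; rfl)
  calc ‖(List.ofFn m).prod * c n‖ = ‖c n‖ * ∏ k, ‖m k‖ := by rw [norm_mul, hprod, mul_comm]
    _ ≤ _ := le_rfl

theorem IsPowerSeriesCoeff.one_le_radius (hc : IsPowerSeriesCoeff c) :
    1 ≤ (powerFormalSeries c).radius := by
  refine ENNReal.le_of_forall_nnreal_lt fun r hr =>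
    (powerFormalSeries c).le_radius_of_summable_norm ?_
  exact Summable.of_nonneg_of_le (fun n => by positivity)
    (fun n => mul_le_mul_of_nonneg_right (norm_powerFormalSeries_le c n) (by positivity))
    (hc r r.2 (by exact_mod_cast hr))

theorem powerFormalSeries_sum (c : ℕ → ℍ) (q : ℍ) :
    (powerFormalSeries c).sum q = ∑' n, q ^ n * c n := by
  refine tsum_congr fun n => ?_
  change (List.ofFn fun _ : Fin n => q).prod * c n = _
  rw [List.ofFn_const, List.prod_replicate]

theorem IsPowerSeriesCoeff.differentiableOn (hc : IsPowerSeriesCoeff c) :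
    DifferentiableOn ℝ (powerSum c) unitBall := by
  have hd := ((powerFormalSeries c).hasFPowerSeriesOnBall
    (one_pos.trans_le hc.one_le_radius)).differentiableOn
  have hsub : unitBall ⊆ Metric.eball 0 (powerFormalSeries c).radius := by
    rw [unitBall, ← Metric.eball_ofReal, ENNReal.ofReal_one]
    exact Metric.eball_subset_eball hc.one_le_radius
  refine (hd.mono hsub).congr fun q hq => ?_
  rw [powerSum, Set.indicator_of_mem hq, powerFormalSeries_sum]

theorem IsPowerSeriesCoeff.summable_norm_toStem (hc : IsPowerSeriesCoeff c) {r : ℝ} (hr : 0 ≤ r)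
    (hr1 : r < 1) : Summable fun n => r ^ n * ‖toStem (c n)‖ := by
  refine Summable.of_nonneg_of_le (fun n => by positivity) (fun n => ?_)
    ((hc r hr hr1).mul_left ‖toStem‖)
  rw [mul_comm, ← mul_assoc]
  exact mul_le_mul_of_nonneg_right (toStem.le_opNorm _) (by positivity)

theorem IsPowerSeriesCoeff.hasSum_stem (hc : IsPowerSeriesCoeff c)
    (hz : z ∈ Metric.ball (0 : ℂ) 1) :
    HasSum (fun n => z ^ n • toStem (c n)) (powerStem c z) := by
  refine (Summable.of_norm_bounded
    (hc.summable_norm_toStem (norm_nonneg z) (mem_ball_zero_iff.1 hz)) fun n => ?_).hasSum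
  rw [norm_smul, norm_pow]

theorem IsPowerSeriesCoeff.differentiableAt_stem (hc : IsPowerSeriesCoeff c)
    (hz : z ∈ Metric.ball (0 : ℂ) 1) : DifferentiableAt ℂ (powerStem c) z := by
  obtain ⟨r, hzr, hr1⟩ := exists_between (mem_ball_zero_iff.1 hz)
  have hr0 : 0 ≤ r := (norm_nonneg z).trans hzr.le
  have hd : DifferentiableOn ℂ (powerStem c) (Metric.ball 0 r) := by
    refine Complex.differentiableOn_tsum_of_summable_norm (hc.summable_norm_toStem hr0 hr1)
      (fun n => by fun_prop) Metric.isOpen_ball fun n w hw => ?_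
    rw [norm_smul, norm_pow]
    gcongr
    exact (mem_ball_zero_iff.1 hw).le
  exact hd.differentiableAt (Metric.isOpen_ball.mem_nhds (mem_ball_zero_iff.2 hzr))

theorem IsPowerSeriesCoeff.powerSum_slicePoint (hc : IsPowerSeriesCoeff c)
    (hz : z ∈ Metric.ball (0 : ℂ) 1) :
    powerSum c (slicePoint J z) = stemEval J (powerStem c z) := by
  refine (hc.hasSum hz).unique (((stemEval J).hasSum (hc.hasSum_stem hz)).congr_fun fun n => ?_)
  rw [stemEval_smul, stemEval_toStem]

theorem IsPowerSeriesCoeff.hasSum_stemRe (hc : IsPowerSeriesCoeff c)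
    (hz : z ∈ Metric.ball (0 : ℂ) 1) :
    HasSum (fun n => (z ^ n).re • c n) (stemRe (powerStem c z)) := by
  refine (stemRe.hasSum (hc.hasSum_stem hz)).congr_fun fun n => ?_
  rw [stemRe_smul, stemRe_toStem, stemIm_toStem, smul_zero, sub_zero]

theorem IsPowerSeriesCoeff.hasSum_stemIm (hc : IsPowerSeriesCoeff c)
    (hz : z ∈ Metric.ball (0 : ℂ) 1) :
    HasSum (fun n => (z ^ n).im • c n) (stemIm (powerStem c z)) := by
  refine (stemIm.hasSum (hc.hasSum_stem hz)).congr_fun fun n => ?_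
  rw [stemIm_smul, stemRe_toStem, stemIm_toStem, smul_zero, zero_add]

theorem IsPowerSeriesCoeff.powerStem_star (hc : IsPowerSeriesCoeff c)
    (hz : z ∈ Metric.ball (0 : ℂ) 1) :
    stemRe (powerStem c (star z)) = stemRe (powerStem c z) ∧
      stemIm (powerStem c (star z)) = -stemIm (powerStem c z) := by
  have hz' : star z ∈ Metric.ball (0 : ℂ) 1 := by
    rwa [mem_ball_zero_iff, norm_star, ← mem_ball_zero_iff]
  constructor
  · refine (hc.hasSum_stemRe hz').unique ((hc.hasSum_stemRe hz).congr_fun fun n => ?_)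
    rw [← star_pow, Complex.star_def, Complex.conj_re]
  · refine (hc.hasSum_stemIm hz').unique ((hc.hasSum_stemIm hz).neg.congr_fun fun n => ?_)
    rw [← star_pow, Complex.star_def, Complex.conj_im, neg_smul]

theorem cauchyRiemann_of_differentiableAt {G : ℂ → StemSpace} (hG : DifferentiableAt ℂ G z) :
    fderiv ℝ (fun w => stemRe (G w)) z 1 = fderiv ℝ (fun w => stemIm (G w)) z Complex.I ∧
      fderiv ℝ (fun w => stemIm (G w)) z 1 =
        -fderiv ℝ (fun w => stemRe (G w)) z Complex.I := by
  obtain ⟨hGd, hGI⟩ := differentiableAt_complex_iff_differentiableAt_real.1 hG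
  have hre : fderiv ℝ (fun w => stemRe (G w)) z = stemRe ∘SL fderiv ℝ G z :=
    (stemRe.hasFDerivAt.comp z hGd.hasFDerivAt).fderiv
  have him : fderiv ℝ (fun w => stemIm (G w)) z = stemIm ∘SL fderiv ℝ G z :=
    (stemIm.hasFDerivAt.comp z hGd.hasFDerivAt).fderiv
  simp [hre, him, hGI, stemRe_smul, stemIm_smul]

theorem IsPowerSeriesCoeff.isLeftSliceHyperholomorphic (hc : IsPowerSeriesCoeff c) :
    IsLeftSliceHyperholomorphic unitBall (powerSum c) := by
  have hd : ∀ z ∈ Metric.ball (0 : ℂ) 1, DifferentiableAt ℝ (powerStem c) z := fun z hz =>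
    (hc.differentiableAt_stem hz).restrictScalars ℝ
  refine ⟨hc.differentiableOn, fun z => stemRe (powerStem c z), fun z => stemIm (powerStem c z),
    fun J hJ z hz => ?_, ?_⟩
  · lift J to imaginaryUnits using hJ
    exact hc.powerSum_slicePoint (slicePoint_mem_unitBall.1 hz)
  · rw [profile_unitBall]
    exact ⟨fun z hz => hc.powerStem_star hz,
      fun z hz => ⟨stemRe.differentiableAt.comp z (hd z hz),
        stemIm.differentiableAt.comp z (hd z hz)⟩,
      fun z hz => cauchyRiemann_of_differentiableAt (hc.differentiableAt_stem hz)⟩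

end PowerSeries

/-! ### The weighted area -/

section WeightedArea

variable {α : ℝ}

/-- The density of `dA_α` with respect to the Lebesgue measure of the disc, as a function of the
modulus. -/
def radialWeight (α r : ℝ) : ℝ := (α + 1) / Real.pi * (1 - r ^ 2) ^ α

theorem measurable_radialWeight : Measurable fun z : ℂ => radialWeight α ‖z‖ := by
  unfold radialWeight
  fun_prop

theorem radialWeight_nonneg (hα : -1 < α) {r : ℝ} (h0 : 0 ≤ r) (h1 : r ≤ 1) :
    0 ≤ radialWeight α r := by
  have : 0 ≤ 1 - r ^ 2 := by nlinarith
  have : 0 ≤ α + 1 := by linarith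
  unfold radialWeight
  positivity

theorem hasDerivAt_one_sub_sq_rpow (α : ℝ) {r : ℝ} (hr : r ∈ Set.Ioo (0 : ℝ) 1) :
    HasDerivAt (fun r : ℝ => (1 - r ^ 2) ^ (α + 1))
      (-(2 * (α + 1)) * (r * (1 - r ^ 2) ^ α)) r := by
  have hpos : 0 < 1 - r ^ 2 := by nlinarith [hr.1, hr.2]
  have hbase : HasDerivAt (fun r : ℝ => 1 - r ^ 2) (-(2 * r)) r := by
    simpa using (hasDerivAt_pow 2 r).const_sub 1
  refine (hbase.rpow_const (p := α + 1) (Or.inl hpos.ne')).congr_deriv ?_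
  rw [add_sub_cancel_right]
  ring

theorem continuousOn_one_sub_sq_rpow (hα : -1 < α) :
    ContinuousOn (fun r : ℝ => (1 - r ^ 2) ^ (α + 1)) (Set.Icc 0 1) :=
  ContinuousOn.rpow_const (by fun_prop) fun _ _ => Or.inr (by linarith)

theorem intervalIntegrable_mul_one_sub_sq_rpow (hα : -1 < α) :
    IntervalIntegrable (fun r : ℝ => r * (1 - r ^ 2) ^ α) volume 0 1 := by
  have hα1 : 0 < α + 1 := by linarith
  have h : IntervalIntegrable (fun r : ℝ => (2 * (α + 1)) * (r * (1 - r ^ 2) ^ α)) volume 0 1 := by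
    refine intervalIntegral.intervalIntegrable_deriv_of_nonneg
      (g := fun r : ℝ => -(1 - r ^ 2) ^ (α + 1)) ?_ (fun r hr => ?_) fun r hr => ?_
    · rw [Set.uIcc_of_le zero_le_one]
      exact (continuousOn_one_sub_sq_rpow hα).neg
    · rw [min_eq_left zero_le_one, max_eq_right zero_le_one] at hr
      exact (hasDerivAt_one_sub_sq_rpow α hr).neg.congr_deriv (by ring)
    · rw [min_eq_left zero_le_one, max_eq_right zero_le_one] at hr
      have : 0 < 1 - r ^ 2 := by nlinarith [hr.1, hr.2]
      have := hr.1
      positivity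
  refine (h.const_mul (2 * (α + 1))⁻¹).congr fun r _ => ?_
  exact inv_mul_cancel_left₀ (by positivity) _

theorem intervalIntegrable_pow_mul_one_sub_sq_rpow (hα : -1 < α) (n : ℕ) :
    IntervalIntegrable (fun r : ℝ => r ^ (2 * n) * (r * (1 - r ^ 2) ^ α)) volume 0 1 :=
  (intervalIntegrable_mul_one_sub_sq_rpow hα).continuousOn_mul (by fun_prop)

/-- The moment `∫ |z|²ⁿ dA_α`, in polar coordinates. It is the square of the norm of the monomial
`qⁿ`. -/
def radialMoment (α : ℝ) (n : ℕ) : ℝ :=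
  2 * (α + 1) * ∫ r in (0 : ℝ)..1, r ^ (2 * n) * (r * (1 - r ^ 2) ^ α)

theorem radialMoment_zero (hα : -1 < α) : radialMoment α 0 = 1 := by
  have hα1 : α + 1 ≠ 0 := by linarith
  have h := intervalIntegral.integral_eq_sub_of_hasDerivAt_of_le zero_le_one
    (continuousOn_one_sub_sq_rpow hα).neg
    (f' := fun r => 2 * (α + 1) * (r ^ (2 * 0) * (r * (1 - r ^ 2) ^ α)))
    (fun r hr => (hasDerivAt_one_sub_sq_rpow α hr).neg.congr_deriv (by ring))
    ((intervalIntegrable_pow_mul_one_sub_sq_rpow hα 0).const_mul _)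
  rw [radialMoment, ← intervalIntegral.integral_const_mul, h]
  simp [Real.zero_rpow hα1]

theorem radialMoment_succ (hα : -1 < α) (n : ℕ) :
    (α + 2 + n) * radialMoment α (n + 1) = (n + 1) * radialMoment α n := by
  have hα1 : α + 1 ≠ 0 := by linarith
  set g : ℕ → ℝ → ℝ := fun n r => r ^ (2 * n) * (r * (1 - r ^ 2) ^ α) with hg
  have hg_int : ∀ n, IntervalIntegrable (g n) volume 0 1 :=
    intervalIntegrable_pow_mul_one_sub_sq_rpow hα
  have hderiv : ∀ r ∈ Set.Ioo (0 : ℝ) 1,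
      HasDerivAt (fun r : ℝ => r ^ (2 * n + 2) * (1 - r ^ 2) ^ (α + 1))
        (2 * (n + 1) * g n r - 2 * (α + 2 + n) * g (n + 1) r) r := fun r hr => by
    have hpos : 0 < 1 - r ^ 2 := by nlinarith [hr.1, hr.2]
    refine ((hasDerivAt_pow (2 * n + 2) r).mul (hasDerivAt_one_sub_sq_rpow α hr)).congr_deriv ?_
    simp only [hg]
    rw [Real.rpow_add_one hpos.ne', show 2 * n + 2 - 1 = 2 * n + 1 by omega]
    push_cast
    ring
  have h := intervalIntegral.integral_eq_sub_of_hasDerivAt_of_le zero_le_one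
    (f := fun r : ℝ => r ^ (2 * n + 2) * (1 - r ^ 2) ^ (α + 1))
    ((continuous_pow (2 * n + 2)).continuousOn.mul (continuousOn_one_sub_sq_rpow hα)) hderiv
    (((hg_int n).const_mul _).sub ((hg_int (n + 1)).const_mul _))
  rw [intervalIntegral.integral_sub ((hg_int n).const_mul _) ((hg_int (n + 1)).const_mul _),
    intervalIntegral.integral_const_mul, intervalIntegral.integral_const_mul] at h
  simp only [one_pow, sub_self, Real.zero_rpow hα1, mul_zero, ne_eq, Nat.add_eq_zero_iff,
    OfNat.ofNat_ne_zero, and_false, not_false_eq_true, zero_pow, zero_mul] at h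
  rw [radialMoment, radialMoment]
  linear_combination (-(α + 1)) * h

theorem radialMoment_pos (hα : -1 < α) (n : ℕ) : 0 < radialMoment α n := by
  induction n with
  | zero => rw [radialMoment_zero hα]; exact one_pos
  | succ n ih =>
    have hpos : 0 < α + 2 + n := by linarith [n.cast_nonneg (α := ℝ)]
    have h : 0 < (α + 2 + n) * radialMoment α (n + 1) := by
      rw [radialMoment_succ hα n]
      positivity
    exact (pos_iff_pos_of_mul_pos h).1 hpos

theorem factorial_mul_inv_radialMoment (hα : -1 < α) (n : ℕ) :
    (n.factorial : ℝ) * (radialMoment α n)⁻¹ = (ascPochhammer ℝ n).eval (α + 2) := by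
  induction n with
  | zero => simp [radialMoment_zero hα]
  | succ n ih =>
    have hsucc := radialMoment_succ hα n
    have hn := (radialMoment_pos hα n).ne'
    have hn1 := (radialMoment_pos hα (n + 1)).ne'
    rw [ascPochhammer_succ_eval, ← ih, Nat.factorial_succ]
    field_simp
    push_cast
    linear_combination -(n.factorial : ℝ) * hsucc

theorem inv_radialMoment (hα : -1 < α) (n : ℕ) :
    (radialMoment α n)⁻¹ = Ring.choose (α + 2 + n - 1) n := by
  have hchoose : (n.factorial : ℝ) * Ring.choose (α + 2 + n - 1) n
      = (ascPochhammer ℝ n).eval (α + 2) := by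
    rw [Ring.choose, show α + 2 + (n : ℝ) - 1 - n + 1 = α + 2 by ring, ← nsmul_eq_mul,
      Ring.factorial_nsmul_multichoose_eq_ascPochhammer, Polynomial.ascPochhammer_smeval_eq_eval]
  exact mul_left_cancel₀ (Nat.cast_ne_zero.2 n.factorial_ne_zero)
    ((factorial_mul_inv_radialMoment hα n).trans hchoose.symm)

theorem hasSum_inv_radialMoment (hα : -1 < α) {x : ℝ} (h0 : 0 ≤ x) (h1 : x < 1) :
    HasSum (fun n => (radialMoment α n)⁻¹ * x ^ n) ((1 - x) ^ (α + 2))⁻¹ := by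
  have h := (Real.one_div_one_sub_rpow_hasFPowerSeriesOnBall_zero (α + 2)).hasSum (y := x) (by
    rw [← ENNReal.ofReal_one, Metric.eball_ofReal, mem_ball_zero_iff, Real.norm_of_nonneg h0]
    exact h1)
  simp only [FormalMultilinearSeries.ofScalars_apply_eq, zero_add, one_div] at h
  refine h.congr_fun fun n => ?_
  rw [inv_radialMoment hα, smul_eq_mul]

theorem weightedArea_eq_withDensity : weightedArea α =
    (volume.restrict (Metric.ball 0 1)).withDensity
      fun z => ENNReal.ofReal (radialWeight α ‖z‖) := rfl

theorem ae_mem_ball : ∀ᵐ z ∂weightedArea α, z ∈ Metric.ball (0 : ℂ) 1 :=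
  (withDensity_absolutelyContinuous _ _).ae_le (ae_restrict_mem Metric.isOpen_ball.measurableSet)

/-- The density of `dA_α` with respect to the Lebesgue measure of the plane, as a function of the
modulus. -/
def discWeight (α : ℝ) : ℝ → ℝ := (Set.Iio 1).indicator (radialWeight α)

theorem integral_weightedArea (hα : -1 < α) (h : ℂ → ℝ) :
    ∫ z, h z ∂weightedArea α = ∫ z, discWeight α ‖z‖ * h z := by
  rw [weightedArea_eq_withDensity, integral_withDensity_eq_integral_toReal_smul₀
    measurable_radialWeight.ennreal_ofReal.aemeasurable
    (ae_of_all _ fun _ => ENNReal.ofReal_lt_top), ← integral_indicator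
    Metric.isOpen_ball.measurableSet]
  refine integral_congr_ae (ae_of_all _ fun z => ?_)
  by_cases hz : ‖z‖ < 1
  · simp [discWeight, hz, ENNReal.toReal_ofReal (radialWeight_nonneg hα (norm_nonneg z) hz.le)]
  · simp [discWeight, hz]

theorem indicator_mul_discWeight (n : ℕ) :
    (Set.Ioi (0 : ℝ)).indicator (fun r => r ^ (2 - 1) • (discWeight α r * r ^ (2 * n)))
      = (Set.Ioo (0 : ℝ) 1).indicator
        fun r => (α + 1) / Real.pi * (r ^ (2 * n) * (r * (1 - r ^ 2) ^ α)) := by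
  ext r
  by_cases h0 : 0 < r <;> by_cases h1 : r < 1
  · simp only [discWeight, radialWeight, Set.indicator, Set.mem_Ioi, Set.mem_Iio, Set.mem_Ioo,
      h0, h1, and_self, if_true, smul_eq_mul]
    ring
  all_goals simp [discWeight, h0, h1]

theorem integrable_discWeight (hα : -1 < α) : Integrable fun z : ℂ => discWeight α ‖z‖ := by
  have h := (integrable_fun_norm_addHaar (volume : Measure ℂ)
    (f := fun r => discWeight α r * r ^ (2 * 0))).2 (by
      rw [Complex.finrank_real_complex, ← integrable_indicator_iff measurableSet_Ioi,
        indicator_mul_discWeight, integrable_indicator_iff measurableSet_Ioo]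
      exact ((intervalIntegrable_iff_integrableOn_Ioo_of_le zero_le_one).1
        ((intervalIntegrable_pow_mul_one_sub_sq_rpow hα 0).const_mul _)))
  simpa using h

theorem integral_norm_pow (hα : -1 < α) (n : ℕ) :
    ∫ z, ‖z‖ ^ (2 * n) ∂weightedArea α = radialMoment α n := by
  rw [integral_weightedArea hα,
    integral_fun_norm_addHaar (volume : Measure ℂ) fun r => discWeight α r * r ^ (2 * n),
    Complex.finrank_real_complex, ← integral_indicator measurableSet_Ioi,
    indicator_mul_discWeight, integral_indicator measurableSet_Ioo,
    ← integral_Ioc_eq_integral_Ioo, ← intervalIntegral.integral_of_le zero_le_one,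
    intervalIntegral.integral_const_mul, radialMoment, Measure.real, Complex.volume_ball]
  simp only [ENNReal.ofReal_one, one_pow, one_mul, ENNReal.coe_toReal, NNReal.coe_real_pi,
    smul_eq_mul, nsmul_eq_mul, Nat.cast_ofNat]
  field_simp

theorem isFiniteMeasure_weightedArea (hα : -1 < α) : IsFiniteMeasure (weightedArea α) := by
  refine isFiniteMeasure_withDensity_ofReal ?_
  have h := (integrable_discWeight hα).integrableOn (s := Metric.ball 0 1)
  refine (h.congr_fun (fun z hz => ?_) Metric.isOpen_ball.measurableSet).2
  have hz1 : ‖z‖ ∈ Set.Iio 1 := mem_ball_zero_iff.1 hz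
  exact Set.indicator_of_mem hz1 _

theorem measurePreserving_rotation (u : Circle) :
    MeasurePreserving (rotation u) (weightedArea α) (weightedArea α) := by
  have hnorm : ∀ z, ‖rotation u z‖ = ‖z‖ := (rotation u).norm_map
  have hball : rotation u ⁻¹' Metric.ball 0 1 = Metric.ball 0 1 := by
    ext z
    rw [Set.mem_preimage, mem_ball_zero_iff, mem_ball_zero_iff, hnorm]
  have hrestrict := (rotation u).measurePreserving.restrict_preimage
    (Metric.isOpen_ball (α := ℂ) (x := 0) (ε := 1)).measurableSet
  rw [hball] at hrestrict
  refine ⟨(rotation u).continuous.measurable, Measure.ext fun s hs => ?_⟩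
  rw [Measure.map_apply (rotation u).continuous.measurable hs, weightedArea_eq_withDensity,
    withDensity_apply _ hs, withDensity_apply _ ((rotation u).continuous.measurable hs),
    ← hrestrict.setLIntegral_comp_preimage hs measurable_radialWeight.ennreal_ofReal]
  simp only [hnorm]

theorem setIntegral_star_pow_mul_pow_of_ne (α r : ℝ) {m n : ℕ} (hmn : m ≠ n) :
    ∫ z in Metric.ball 0 r, star z ^ n * z ^ m ∂weightedArea α = 0 := by
  -- Rotating by `exp (iπ / (m - n))` changes the sign of the integrand.
  set θ : ℝ := Real.pi / ((m : ℝ) - n) with hθ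
  have hne : (m : ℂ) - n ≠ 0 := sub_ne_zero.2 (by exact_mod_cast hmn)
  have hθπ : (θ : ℂ) * (m - n) = Real.pi := by
    rw [hθ]
    push_cast
    exact div_mul_cancel₀ _ hne
  have hexp : star (Circle.exp θ : ℂ) ^ n * (Circle.exp θ : ℂ) ^ m = -1 := by
    rw [Circle.coe_exp, Complex.star_def, ← Complex.exp_conj, ← Complex.exp_nat_mul,
      ← Complex.exp_nat_mul, ← Complex.exp_add, ← Complex.exp_pi_mul_I, ← hθπ]
    simp only [map_mul, Complex.conj_ofReal, Complex.conj_I]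
    ring_nf
  have hball : rotation (Circle.exp θ) ⁻¹' Metric.ball 0 r = Metric.ball 0 r := by
    ext z
    rw [Set.mem_preimage, mem_ball_zero_iff, mem_ball_zero_iff, LinearIsometryEquiv.norm_map]
  have h := (measurePreserving_rotation (α := α) (Circle.exp θ)).setIntegral_preimage_emb
    (rotation (Circle.exp θ)).toHomeomorph.measurableEmbedding (fun z => star z ^ n * z ^ m)
    (Metric.ball 0 r)
  have hneg : ∀ z : ℂ, star (rotation (Circle.exp θ) z) ^ n * rotation (Circle.exp θ) z ^ m
      = -(star z ^ n * z ^ m) := fun z => by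
    rw [rotation_apply, star_mul, mul_pow, mul_pow]
    linear_combination (star z ^ n * z ^ m) * hexp
  simp only [hball, hneg, integral_neg] at h
  exact neg_eq_self.1 h

theorem tendsto_setIntegral_ball {F : Type*} [NormedAddCommGroup F] [NormedSpace ℝ F]
    {g : ℂ → F} (hg : Integrable g (weightedArea α)) :
    Tendsto (fun r : ℝ => ∫ z in Metric.ball 0 r, g z ∂weightedArea α) (𝓝[<] 1)
      (𝓝 (∫ z, g z ∂weightedArea α)) := by
  refine AECover.integral_tendsto_of_countably_generated ⟨?_, fun r =>
    Metric.isOpen_ball.measurableSet⟩ hg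
  filter_upwards [ae_mem_ball] with z hz
  filter_upwards [Ioo_mem_nhdsLT (mem_ball_zero_iff.1 hz)] with r hr
  exact mem_ball_zero_iff.2 hr.1

end WeightedArea

/-! ### Coefficients as scalar products -/

section Coefficients

variable {α r : ℝ} {J : imaginaryUnits} {c : ℕ → ℍ} {F : ℂ → ℍ}

theorem isPowerSeriesCoeff_of_hasSum
    (hF : ∀ z ∈ Metric.ball (0 : ℂ) 1, HasSum (fun n => slicePoint J (z ^ n) * c n) (F z)) :
    IsPowerSeriesCoeff c := fun r h0 h1 => by
  have hr : (r : ℂ) ∈ Metric.ball (0 : ℂ) 1 := by simpa [abs_of_nonneg h0] using h1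
  refine (hF r hr).summable.norm.congr fun n => ?_
  rw [norm_mul, norm_slicePoint, norm_pow, Complex.norm_real, Real.norm_of_nonneg h0, mul_comm]

theorem star_pow_mul_pow_self (z : ℂ) (n : ℕ) :
    star z ^ n * z ^ n = ((‖z‖ ^ (2 * n) : ℝ) : ℂ) := by
  rw [← mul_pow, Complex.star_def, Complex.conj_mul', ← pow_mul, Complex.ofReal_pow]

theorem norm_star_pow_mul_pow_le {z : ℂ} (hz : z ∈ Metric.ball (0 : ℂ) 1) (n m : ℕ) :
    ‖star z ^ n * z ^ m‖ ≤ ‖z‖ ^ m := by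
  rw [norm_mul, norm_pow, norm_pow, norm_star]
  exact mul_le_of_le_one_left (by positivity)
    (pow_le_one₀ (norm_nonneg z) (mem_ball_zero_iff.1 hz).le)

theorem integrable_star_pow_mul_pow (hα : -1 < α) (n m : ℕ) :
    Integrable (fun z : ℂ => star z ^ n * z ^ m) (weightedArea α) := by
  have := isFiniteMeasure_weightedArea hα
  refine Integrable.of_bound (by fun_prop) 1 ?_
  filter_upwards [ae_mem_ball] with z hz
  exact (norm_star_pow_mul_pow_le hz n m).trans
    (pow_le_one₀ (norm_nonneg z) (mem_ball_zero_iff.1 hz).le)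

theorem integrable_slicePoint_star_pow_mul_pow (hα : -1 < α) (n m : ℕ) (q : ℍ) :
    Integrable (fun z => slicePoint J (star z ^ n * z ^ m) * q) (weightedArea α) := by
  simpa only [sliceCLM_apply] using
    ((sliceCLM J).integrable_comp (integrable_star_pow_mul_pow hα n m)).mul_const q

theorem setIntegral_slicePoint_star_pow_mul_pow (hα : -1 < α) (r : ℝ) (n m : ℕ) (q : ℍ) :
    ∫ z in Metric.ball 0 r, slicePoint J (star z ^ n * z ^ m) * q ∂weightedArea α
      = if m = n then (∫ z in Metric.ball 0 r, ‖z‖ ^ (2 * n) ∂weightedArea α) • q else 0 := by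
  have hcomm := ((mulRight q).comp (sliceCLM J)).integral_comp_comm
    ((integrable_star_pow_mul_pow hα n m).restrict (s := Metric.ball 0 r))
  have hcomp : ∀ z, ((mulRight q).comp (sliceCLM J)) z = slicePoint J z * q := fun z => by
    rw [ContinuousLinearMap.comp_apply, sliceCLM_apply]
    rfl
  simp only [hcomp] at hcomm
  rw [hcomm]
  split_ifs with hmn
  · subst hmn
    simp only [star_pow_mul_pow_self]
    rw [integral_complex_ofReal, slicePoint_ofReal, Quaternion.coe_mul_eq_smul]
  · rw [setIntegral_star_pow_mul_pow_of_ne α r hmn, ← sliceCLM_apply, map_zero, zero_mul]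

theorem IsPowerSeriesCoeff.summable_setIntegral_norm (hc : IsPowerSeriesCoeff c) (hα : -1 < α)
    (hr : r ∈ Set.Ioo (0 : ℝ) 1) (n : ℕ) :
    Summable fun m =>
      ∫ z in Metric.ball 0 r, ‖slicePoint J (star z ^ n * z ^ m) * c m‖ ∂weightedArea α := by
  have := isFiniteMeasure_weightedArea hα
  set μ := (weightedArea α).restrict (Metric.ball 0 r)
  refine Summable.of_nonneg_of_le (fun m => integral_nonneg fun z => norm_nonneg _) (fun m => ?_)
    ((hc r hr.1.le hr.2).mul_left (μ.real Set.univ))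
  have hle : ∀ᵐ z ∂μ, ‖slicePoint J (star z ^ n * z ^ m) * c m‖ ≤ ‖c m‖ * r ^ m := by
    filter_upwards [ae_restrict_mem Metric.isOpen_ball.measurableSet] with z hz
    rw [norm_mul, norm_slicePoint, mul_comm]
    gcongr
    exact (norm_star_pow_mul_pow_le (Metric.ball_subset_ball hr.2.le hz) n m).trans
      (pow_le_pow_left₀ (norm_nonneg z) (mem_ball_zero_iff.1 hz).le m)
  calc ∫ z, ‖slicePoint J (star z ^ n * z ^ m) * c m‖ ∂μ ≤ ∫ _, ‖c m‖ * r ^ m ∂μ :=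
        integral_mono_ae (integrable_slicePoint_star_pow_mul_pow hα n m _).restrict.norm
          (integrable_const _) hle
    _ = μ.real Set.univ * (‖c m‖ * r ^ m) := by rw [integral_const, smul_eq_mul]

theorem setIntegral_star_pow_mul (hα : -1 < α)
    (hF : ∀ z ∈ Metric.ball (0 : ℂ) 1, HasSum (fun n => slicePoint J (z ^ n) * c n) (F z))
    (hr : r ∈ Set.Ioo (0 : ℝ) 1) (n : ℕ) :
    ∫ z in Metric.ball 0 r, slicePoint J (star z ^ n) * F z ∂weightedArea α
      = (∫ z in Metric.ball 0 r, ‖z‖ ^ (2 * n) ∂weightedArea α) • c n := by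
  have hsum := hasSum_integral_of_summable_integral_norm
    (fun m => (integrable_slicePoint_star_pow_mul_pow (J := J) hα n m (c m)).restrict)
    ((isPowerSeriesCoeff_of_hasSum hF).summable_setIntegral_norm hα hr n)
  simp only [setIntegral_slicePoint_star_pow_mul_pow hα] at hsum
  refine (setIntegral_congr_fun Metric.isOpen_ball.measurableSet fun z hz => ?_).trans
    (hsum.unique ((hasSum_ite_eq n _).congr_fun fun m => ?_))
  · have hz1 := (hF z (Metric.ball_subset_ball hr.2.le hz)).mul_left (slicePoint J (star z ^ n))
    simpa only [slicePoint_mul, mul_assoc] using hz1.tsum_eq.symm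
  · split_ifs with hmn
    · rw [hmn]
    · rfl

theorem norm_slicePoint_star_pow_mul_le {z : ℂ} (hz : z ∈ Metric.ball (0 : ℂ) 1) (n : ℕ) (q : ℍ) :
    ‖slicePoint J (star z ^ n) * q‖ ≤ ‖q‖ := by
  rw [norm_mul, norm_slicePoint, norm_pow, norm_star]
  exact mul_le_of_le_one_left (norm_nonneg q)
    (pow_le_one₀ (norm_nonneg z) (mem_ball_zero_iff.1 hz).le)

theorem integrable_star_pow_mul (hF : Integrable F (weightedArea α)) (n : ℕ) :
    Integrable (fun z => slicePoint J (star z ^ n) * F z) (weightedArea α) := by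
  refine hF.mono ((continuous_slicePoint.comp (by fun_prop)).aestronglyMeasurable.mul
    hF.aestronglyMeasurable) ?_
  filter_upwards [ae_mem_ball] with z hz
  exact norm_slicePoint_star_pow_mul_le hz n (F z)

theorem integral_norm_star_pow_mul_le (hF : Integrable F (weightedArea α)) (n : ℕ) :
    ∫ z, ‖slicePoint J (star z ^ n) * F z‖ ∂weightedArea α ≤ ∫ z, ‖F z‖ ∂weightedArea α := by
  refine integral_mono_ae (integrable_star_pow_mul hF n).norm hF.norm ?_
  filter_upwards [ae_mem_ball] with z hz
  exact norm_slicePoint_star_pow_mul_le hz n (F z)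

theorem integral_star_pow_mul (hα : -1 < α)
    (hF : ∀ z ∈ Metric.ball (0 : ℂ) 1, HasSum (fun n => slicePoint J (z ^ n) * c n) (F z))
    (hFi : Integrable F (weightedArea α)) (n : ℕ) :
    ∫ z, slicePoint J (star z ^ n) * F z ∂weightedArea α = radialMoment α n • c n := by
  -- The series converges uniformly only on smaller discs; their radius tends to `1` here.
  have hpow : Integrable (fun z : ℂ => ‖z‖ ^ (2 * n)) (weightedArea α) := by
    simpa only [norm_mul, norm_pow, norm_star, ← pow_add, ← two_mul] using
      (integrable_star_pow_mul_pow hα n n).norm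
  have hlim := (tendsto_setIntegral_ball hpow).smul_const (c n)
  rw [integral_norm_pow hα] at hlim
  refine tendsto_nhds_unique (tendsto_setIntegral_ball (integrable_star_pow_mul hFi n))
    (hlim.congr' ?_)
  filter_upwards [Ioo_mem_nhdsLT one_pos] with r hr
  exact (setIntegral_star_pow_mul hα hF hr n).symm

end Coefficients

/-! ### The slice Bergman space -/

section Bergman

variable {α : ℝ} {i : imaginaryUnits} {c d : ℕ → ℍ} {w : ℂ}

/-- Quaternionic conjugation as a real continuous linear map. -/
def starCLM : ℍ →L[ℝ] ℍ :=
  LinearMap.toContinuousLinearMap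
    { toFun := star, map_add' := star_add, map_smul' := fun r q => Quaternion.star_smul r q }

theorem inner_eq_integral (f g : BergmanSpace α i) :
    ⟪f, g⟫_ℍ = ∫ z, star (f (slicePoint i z)) * g (slicePoint i z) ∂weightedArea α := rfl

theorem integrable_star_mul (f g : BergmanSpace α i) :
    Integrable (fun z => star (f (slicePoint i z)) * g (slicePoint i z)) (weightedArea α) :=
  f.memLp.star.integrable_mul g.memLp

instance : QuaternionicInnerProductSpace (BergmanSpace α i) where
  star_inner f g := by
    refine (starCLM.integral_comp_comm (integrable_star_mul f g)).symm.trans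
      (integral_congr_ae (ae_of_all _ fun z => ?_))
    exact (star_mul _ _).trans (by rw [star_star])
  inner_add f g h := by
    rw [inner_eq_integral, inner_eq_integral, inner_eq_integral,
      ← integral_add (integrable_star_mul f g) (integrable_star_mul f h)]
    exact integral_congr_ae (ae_of_all _ fun z => mul_add _ _ _)
  inner_op_smul f g q := by
    refine .trans (integral_congr_ae (ae_of_all _ fun z => ?_))
      ((mulRight q).integral_comp_comm (integrable_star_mul f g))
    exact (mul_assoc _ _ _).symm
  inner_self_eq f := by
    rw [f.norm_sq_eq, inner_eq_integral]
    simp only [quaternion_star_mul_self]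
    exact (Algebra.linearMap ℝ ℍ).toContinuousLinearMap.integral_comp_comm
      (f.memLp.integrable_norm_pow two_ne_zero)

theorem integrable_slice (hα : -1 < α) (f : BergmanSpace α i) :
    Integrable (fun z => f (slicePoint i z)) (weightedArea α) := by
  have := isFiniteMeasure_weightedArea hα
  exact f.memLp.integrable one_le_two

theorem isPowerSeriesCoeff_of_summable_norm (hc : Summable fun n => ‖c n‖) :
    IsPowerSeriesCoeff c := fun r h0 h1 =>
  Summable.of_nonneg_of_le (fun n => by positivity)
    (fun n => mul_le_of_le_one_right (norm_nonneg _) (pow_le_one₀ h0 h1.le)) hc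

theorem norm_powerSum_le (hc : Summable fun n => ‖c n‖) {z : ℂ}
    (hz : z ∈ Metric.ball (0 : ℂ) 1) : ‖powerSum c (slicePoint i z)‖ ≤ ∑' n, ‖c n‖ := by
  refine ((isPowerSeriesCoeff_of_summable_norm hc).hasSum hz).norm_le_of_bounded hc.hasSum
    fun n => ?_
  rw [norm_mul, norm_slicePoint, norm_pow]
  exact mul_le_of_le_one_left (norm_nonneg _)
    (pow_le_one₀ (norm_nonneg z) (mem_ball_zero_iff.1 hz).le)

theorem aestronglyMeasurable_slice {f : ℍ → ℍ} (hf : DifferentiableOn ℝ f unitBall) :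
    AEStronglyMeasurable (fun z => f (slicePoint i z)) (weightedArea α) := by
  have h : ContinuousOn (fun z => f (slicePoint i z)) (Metric.ball 0 1) :=
    hf.continuousOn.comp continuous_slicePoint.continuousOn
      fun z hz => slicePoint_mem_unitBall.2 hz
  exact (h.aestronglyMeasurable Metric.isOpen_ball.measurableSet).mono_ac
    (withDensity_absolutelyContinuous _ _)

theorem memLp_powerSum (hα : -1 < α) (hc : Summable fun n => ‖c n‖) :
    MemLp (fun z => powerSum c (slicePoint i z)) 2 (weightedArea α) := by
  have := isFiniteMeasure_weightedArea hα
  refine MemLp.of_bound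
    (aestronglyMeasurable_slice (isPowerSeriesCoeff_of_summable_norm hc).differentiableOn)
    (∑' n, ‖c n‖) ?_
  filter_upwards [ae_mem_ball] with z hz
  exact norm_powerSum_le hc hz

/-- The power series `∑ qⁿ c_n` as an element of the Bergman space. Summability of the
coefficients makes it bounded, which is enough for the kernel and the monomials. -/
def powerSeries (hα : -1 < α) (i : imaginaryUnits) (hc : Summable fun n => ‖c n‖) :
    BergmanSpace α i :=
  ⟨powerSum c, (isPowerSeriesCoeff_of_summable_norm hc).isLeftSliceHyperholomorphic,
    fun _ hx => powerSum_eq_zero hx, memLp_powerSum hα hc⟩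

theorem hasSum_powerSeries (hα : -1 < α) (hc : Summable fun n => ‖c n‖)
    (hw : w ∈ Metric.ball (0 : ℂ) 1) :
    HasSum (fun n => slicePoint i (w ^ n) * c n) (powerSeries hα i hc (slicePoint i w)) :=
  (isPowerSeriesCoeff_of_summable_norm hc).hasSum hw

theorem hasSum_inner_powerSeries (hα : -1 < α) (hc : Summable fun n => ‖c n‖)
    {f : BergmanSpace α i} (hf : ∀ z ∈ Metric.ball (0 : ℂ) 1,
      HasSum (fun n => slicePoint i (z ^ n) * d n) (f (slicePoint i z))) :
    HasSum (fun n => radialMoment α n • (star (c n) * d n)) ⟪powerSeries hα i hc, f⟫_ℍ := by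
  have hfi := integrable_slice hα f
  have hsum := hasSum_integral_of_summable_integral_norm (μ := weightedArea α)
    (F := fun n z => star (c n) * (slicePoint i (star z ^ n) * f (slicePoint i z)))
    (fun n => (integrable_star_pow_mul hfi n).const_mul _) (by
      refine Summable.of_nonneg_of_le (fun n => integral_nonneg fun z => norm_nonneg _)
        (fun n => ?_) (hc.mul_right (∫ z, ‖f (slicePoint i z)‖ ∂weightedArea α))
      simp only [norm_mul (star (c n)), norm_star (c n), integral_const_mul]
      exact mul_le_mul_of_nonneg_left (integral_norm_star_pow_mul_le hfi n) (norm_nonneg _))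
  have hswap : ⟪powerSeries hα i hc, f⟫_ℍ = ∫ z, ∑' n,
      star (c n) * (slicePoint i (star z ^ n) * f (slicePoint i z)) ∂weightedArea α := by
    refine integral_congr_ae ?_
    filter_upwards [ae_mem_ball] with z hz
    have hz' := (hasSum_powerSeries (i := i) hα hc hz).star.mul_right (f (slicePoint i z))
    simpa only [star_mul, star_slicePoint, star_pow, mul_assoc] using hz'.tsum_eq.symm
  rw [hswap]
  refine hsum.congr_fun fun n => ?_
  rw [integral_const_mul_of_integrable (integrable_star_pow_mul hfi n),
    integral_star_pow_mul hα hf hfi, mul_smul_comm]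

/-! ### The reproducing kernel -/

/-- The power series coefficients of the reproducing kernel at the point `w` of the slice. -/
def kernelCoeff (α : ℝ) (i : imaginaryUnits) (w : ℂ) (n : ℕ) : ℍ :=
  (radialMoment α n)⁻¹ • slicePoint i (star w ^ n)

theorem summable_norm_kernelCoeff (hα : -1 < α) (i : imaginaryUnits)
    (hw : w ∈ Metric.ball (0 : ℂ) 1) : Summable fun n => ‖kernelCoeff α i w n‖ := by
  refine (hasSum_inv_radialMoment hα (norm_nonneg w) (mem_ball_zero_iff.1 hw)).summable.congr
    fun n => ?_
  rw [kernelCoeff, norm_smul, norm_slicePoint, norm_pow, norm_star,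
    Real.norm_of_nonneg (inv_nonneg.2 (radialMoment_pos hα n).le)]

/-- The power series of the reproducing kernel, as an element of the Bergman space. -/
def kernelElement (hα : -1 < α) (i : imaginaryUnits) (hw : w ∈ Metric.ball (0 : ℂ) 1) :
    BergmanSpace α i :=
  powerSeries hα i (summable_norm_kernelCoeff hα i hw)

theorem inner_kernelElement (hα : -1 < α) (hw : w ∈ Metric.ball (0 : ℂ) 1)
    (f : BergmanSpace α i) : ⟪kernelElement hα i hw, f⟫_ℍ = f (slicePoint i w) := by
  obtain ⟨d, hd⟩ := IsLeftSliceHyperholomorphic.exists_hasSum f.2.1 i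
  refine (hasSum_inner_powerSeries hα _ hd).unique ((hd w hw).congr_fun fun n => ?_)
  rw [kernelCoeff, Quaternion.star_smul, star_slicePoint, star_pow, star_star, smul_mul_assoc,
    smul_inv_smul₀ (radialMoment_pos hα n).ne']

theorem inner_kernel (hα : -1 < α) (hw : w ∈ Metric.ball (0 : ℂ) 1) (f : BergmanSpace α i) :
    ⟪kernel α i (slicePoint i w), f⟫_ℍ = f (slicePoint i w) := by
  have h : ∃ K : BergmanSpace α i, ∀ f : BergmanSpace α i, ⟪K, f⟫_ℍ = f (slicePoint i w) :=
    ⟨kernelElement hα i hw, inner_kernelElement hα hw⟩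
  rw [kernel, dif_pos h]
  exact h.choose_spec f

theorem kernelElement_apply_self (hα : -1 < α) (hw : w ∈ Metric.ball (0 : ℂ) 1) :
    kernelElement hα i hw (slicePoint i w) = ((((1 - ‖w‖ ^ 2) ^ (α + 2))⁻¹ : ℝ) : ℍ) := by
  have hsum := (hasSum_inv_radialMoment hα (sq_nonneg ‖w‖)
    (pow_lt_one₀ (norm_nonneg w) (mem_ball_zero_iff.1 hw) two_ne_zero)).map (algebraMap ℝ ℍ)
    (continuous_algebraMap ℝ ℍ)
  refine (hasSum_powerSeries hα _ hw).unique (hsum.congr_fun fun n => ?_)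
  rw [kernelCoeff, mul_smul_comm, ← slicePoint_mul, mul_comm (w ^ n), star_pow_mul_pow_self,
    slicePoint_ofReal, ← Quaternion.coe_mul_eq_smul, ← Quaternion.coe_mul, pow_mul]
  rfl

theorem kernel_apply_self (hα : -1 < α) (hw : w ∈ Metric.ball (0 : ℂ) 1) :
    kernel α i (slicePoint i w) (slicePoint i w)
      = ((((1 - ‖w‖ ^ 2) ^ (α + 2))⁻¹ : ℝ) : ℍ) := by
  rw [← inner_kernelElement hα hw, ← QuaternionicInnerProductSpace.star_inner, inner_kernel hα hw,
    kernelElement_apply_self hα hw, Quaternion.star_coe]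

theorem norm_kernel_sq (hα : -1 < α) (hw : w ∈ Metric.ball (0 : ℂ) 1) :
    ‖kernel α i (slicePoint i w)‖ ^ 2 = ((1 - ‖w‖ ^ 2) ^ (α + 2))⁻¹ := by
  rw [← re_inner_self, inner_kernel hα hw, kernel_apply_self hα hw, Quaternion.re_coe]

theorem isParsevalFrame_kernel (hα : -1 < α) (i : imaginaryUnits) :
    IsParsevalFrame (fun z => kernel α i (slicePoint i z)) (weightedArea α) := by
  have hreproduce (f g : BergmanSpace α i) : ∀ᵐ z ∂weightedArea α,
      star (f (slicePoint i z)) * g (slicePoint i z)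
        = ⟪f, kernel α i (slicePoint i z)⟫_ℍ * ⟪kernel α i (slicePoint i z), g⟫_ℍ := by
    filter_upwards [ae_mem_ball] with z hz
    rw [← QuaternionicInnerProductSpace.star_inner, inner_kernel hα hz, inner_kernel hα hz]
  exact ⟨fun f g => (integrable_star_mul f g).congr (hreproduce f g),
    fun f g => (integral_congr_ae (hreproduce f g)).symm⟩

/-! ### The monomials -/

theorem summable_norm_single (n : ℕ) (q : ℍ) : Summable fun m => ‖(Pi.single n q : ℕ → ℍ) m‖ :=
  summable_of_ne_finset_zero (s := {n}) fun m hm => by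
    rw [Pi.single_eq_of_ne (Finset.notMem_singleton.1 hm), norm_zero]

/-- The normalized monomials `qⁿ / ‖qⁿ‖`. -/
def monomial (hα : -1 < α) (i : imaginaryUnits) (n : ℕ) : BergmanSpace α i :=
  powerSeries hα i (summable_norm_single n (((√(radialMoment α n))⁻¹ : ℝ) : ℍ))

theorem isOrthonormalFamily_monomial (hα : -1 < α) (i : imaginaryUnits) :
    IsOrthonormalFamily (monomial hα i) := fun m n => by
  have hsum := hasSum_inner_powerSeries hα
    (summable_norm_single m (((√(radialMoment α m))⁻¹ : ℝ) : ℍ))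
    fun z hz => hasSum_powerSeries (i := i) hα
      (summable_norm_single n (((√(radialMoment α n))⁻¹ : ℝ) : ℍ)) hz
  rw [monomial, monomial, ← hsum.tsum_eq, tsum_eq_single m fun k hk => by
    rw [Pi.single_eq_of_ne hk, star_zero, zero_mul, smul_zero], Pi.single_eq_same]
  split_ifs with hmn
  · have hm := radialMoment_pos hα m
    rw [← hmn, Pi.single_eq_same, Quaternion.star_coe, ← Quaternion.coe_mul,
      ← Quaternion.coe_mul_eq_smul, ← Quaternion.coe_mul, ← mul_inv, Real.mul_self_sqrt hm.le,
      mul_inv_cancel₀ hm.ne', Quaternion.coe_one]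
  · rw [Pi.single_eq_of_ne hmn, mul_zero, smul_zero]

theorem monomial_apply (hα : -1 < α) (hw : w ∈ Metric.ball (0 : ℂ) 1) (n : ℕ) :
    monomial hα i n (slicePoint i w)
      = slicePoint i (w ^ n) * (((√(radialMoment α n))⁻¹ : ℝ) : ℍ) := by
  refine (hasSum_powerSeries hα _ hw).unique ?_
  convert hasSum_single n fun m hm => ?_ using 1
  · rw [Pi.single_eq_same]
  · rw [Pi.single_eq_of_ne hm, mul_zero]

theorem norm_inner_monomial_kernel_sq (hα : -1 < α) (hw : w ∈ Metric.ball (0 : ℂ) 1) (n : ℕ) :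
    ‖⟪monomial hα i n, kernel α i (slicePoint i w)⟫_ℍ‖ ^ 2
      = (radialMoment α n)⁻¹ * (‖w‖ ^ 2) ^ n := by
  rw [← QuaternionicInnerProductSpace.star_inner, norm_star, inner_kernel hα hw,
    monomial_apply hα hw, norm_mul, norm_slicePoint, Quaternion.norm_coe, mul_pow, norm_pow,
    Real.norm_eq_abs, sq_abs, inv_pow, Real.sq_sqrt (radialMoment_pos hα n).le]
  ring

theorem tendsto_partialProjection_kernel (hα : -1 < α) (hw : w ∈ Metric.ball (0 : ℂ) 1) :
    Tendsto (fun N => partialProjection (monomial hα i) (Finset.range N)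
      (kernel α i (slicePoint i w))) atTop (𝓝 (kernel α i (slicePoint i w))) := by
  have hsum := (hasSum_inv_radialMoment hα (sq_nonneg ‖w‖)
    (pow_lt_one₀ (norm_nonneg w) (mem_ball_zero_iff.1 hw) two_ne_zero)).tendsto_sum_nat
  have hsq := hsum.const_sub ((1 - ‖w‖ ^ 2) ^ (α + 2))⁻¹
  simp only [sub_self, ← norm_inner_monomial_kernel_sq (i := i) hα hw,
    ← norm_kernel_sq (i := i) hα hw,
    ← (isOrthonormalFamily_monomial hα i).norm_sub_partialProjection_sq] at hsq
  refine tendsto_iff_norm_sub_tendsto_zero.2 ?_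
  simpa only [norm_sub_rev, Real.sqrt_sq (norm_nonneg _), Real.sqrt_zero] using hsq.sqrt

/-! ### The Berezin transform -/

variable {T : BergmanSpace α i →L[ℍᵐᵒᵖ] BergmanSpace α i}

theorem one_sub_norm_sq_pos (hw : w ∈ Metric.ball (0 : ℂ) 1) : 0 < 1 - ‖w‖ ^ 2 :=
  sub_pos.2 (pow_lt_one₀ (norm_nonneg w) (mem_ball_zero_iff.1 hw) two_ne_zero)

theorem berezin_re (hα : -1 < α) (hw : w ∈ Metric.ball (0 : ℂ) 1) :
    (berezin T (slicePoint i w)).re = (1 - ‖w‖ ^ 2) ^ (α + 2) *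
      (⟪kernel α i (slicePoint i w), T (kernel α i (slicePoint i w))⟫_ℍ : ℍ).re := by
  have hpos : 0 < (1 - ‖w‖ ^ 2) ^ (α + 2) := Real.rpow_pos_of_pos (one_sub_norm_sq_pos hw) _
  rw [berezin, normalizedKernel, map_smul, QuaternionicInnerProductSpace.inner_op_smul,
    op_smul_inner, kernel_apply_self hα hw, Quaternion.re_coe, Quaternion.star_coe,
    ← Quaternion.coe_commutes, ← mul_assoc, ← Quaternion.coe_mul, Quaternion.coe_mul_eq_smul,
    Quaternion.re_smul, smul_eq_mul, ← mul_inv, Real.mul_self_sqrt (by positivity), inv_inv]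

theorem lintegral_berezin (hα : -1 < α) (T : BergmanSpace α i →L[ℍᵐᵒᵖ] BergmanSpace α i) :
    ENNReal.ofReal (α + 1) * ∫⁻ z, ENNReal.ofReal (berezin T (slicePoint i z)).re ∂mobiusMeasure
      = ∫⁻ z, ENNReal.ofReal (⟪kernel α i (slicePoint i z),
          T (kernel α i (slicePoint i z))⟫_ℍ : ℍ).re ∂weightedArea α := by
  rw [mobiusMeasure, weightedArea,
    lintegral_withDensity_eq_lintegral_mul_non_measurable _ (by fun_prop)
      (ae_of_all _ fun _ => ENNReal.ofReal_lt_top),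
    lintegral_withDensity_eq_lintegral_mul_non_measurable _ (by fun_prop)
      (ae_of_all _ fun _ => ENNReal.ofReal_lt_top),
    ← lintegral_const_mul' _ _ ENNReal.ofReal_ne_top]
  refine lintegral_congr_ae ?_
  filter_upwards [ae_restrict_mem Metric.isOpen_ball.measurableSet] with z hz
  have hpos := one_sub_norm_sq_pos hz
  have hα1 : 0 ≤ α + 1 := by linarith
  simp only [Pi.mul_apply]
  rw [berezin_re hα hz, ← ENNReal.ofReal_mul (by positivity), ← ENNReal.ofReal_mul hα1,
    ← ENNReal.ofReal_mul (by positivity), Real.rpow_add hpos, Real.rpow_two]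
  congr 1
  field_simp

theorem tsum_singularNumber_eq_lintegral_berezin (hα : -1 < α) (hT : IsPositiveOperator T) :
    ∑' n, ENNReal.ofReal (singularNumber T n) = ENNReal.ofReal (α + 1) *
      ∫⁻ z, ENNReal.ofReal (berezin T (slicePoint i z)).re ∂mobiusMeasure := by
  rw [lintegral_berezin hα]
  refine (isParsevalFrame_kernel hα i).tsum_singularNumber_eq hT
    (isOrthonormalFamily_monomial hα i) ?_
  filter_upwards [ae_mem_ball] with z hz
  exact tendsto_partialProjection_kernel hα hz

end Bergman

end SliceBergman

end

theorem mainTheorem3 (α : ℝ) (hα : -1 < α) (i : SliceBergman.imaginaryUnits)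
    (T : SliceBergman.BergmanSpace α i →L[ℍᵐᵒᵖ] SliceBergman.BergmanSpace α i)
    (hT : SliceBergman.IsPositiveOperator T) :
    (∑' n : ℕ, ENNReal.ofReal (SliceBergman.singularNumber T n) =
      ENNReal.ofReal (α + 1) *
        ∫⁻ z : ℂ, ENNReal.ofReal (SliceBergman.berezin T (SliceBergman.slicePoint i z)).re
          ∂SliceBergman.mobiusMeasure) ∧
    (∀ s : ℕ → ℝ, SliceBergman.IsSingularValueSeq T s →
      ∑' n : ℕ, ENNReal.ofReal (s n) =
        ENNReal.ofReal (α + 1) *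
          ∫⁻ z : ℂ, ENNReal.ofReal (SliceBergman.berezin T (SliceBergman.slicePoint i z)).re
            ∂SliceBergman.mobiusMeasure) := by
  have htrace := SliceBergman.tsum_singularNumber_eq_lintegral_berezin hα hT
  refine ⟨htrace, fun s hs => ?_⟩
  simpa only [hs.singularNumber_eq] using htrace
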